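/- Let $(X,R,Y,\check R)$ be a reduced root datum with $R$ finite, that is, the root datum of a connected reductive group $G$ over an algebraically closed field with respect to a maximal torus $T$ ($X$ the characters and $Y$ the cocharacters of $T$, $\langle\,,\rangle:Y\times X\to\mathbf Z$ the pairing, $\alpha\mapsto\alpha^\vee$ the bijection $R\to\check R$). Fix a set of simple roots $\{\alpha_s\}$ (that is, a Borel subgroup containing $T$), let $R^+$ be the set of positive roots, let $W$ be the Weyl group, acting on $X$ and on $Y$, let $S\subset W$ be the set of simple reflections, $w\mapsto|w|$ the length function, $W_2=\{w\in W: w^2=1\}$, and let $L\subset Y$ be the subgroup generated by the simple coroots $\alpha_s^\vee$, $s\in S$. Theorem. There is a unique map $W_2\to L$, $w\mapsto r_w$, such that (i) $r_1=0$ and $r_s=\alpha_s^\vee$ for every $s\in S$; (ii) for all $w\in W_2$, $s\in S$ with $sw\ne ws$ we have $s(r_w)=r_{sws}$; (iii) for all $w\in W_2$, $s\in S$ with $sw=ws$ we have $r_{sw}=r_w+n\,\alpha_s^\vee$ for some $n\in\mathbf Z$. Moreover, in (iii) necessarily $n\in\{-1,0,1\}$, and $n\in\{-1,1\}$ if the root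 datum is simply laced (all off-diagonal entries of the Cartan matrix are $0$ or $-1$). In addition: (iv) if $w\in W_2$, $s\in S$, $sw=ws$ and $|sw|>|w|$, then $s(r_w)=r_w$; (v) $w(r_w)=-r_w$ for every $w\in W_2$; (vi) for every $w\in W_2$, $r_w=\sum_{\beta\in\mathcal E_w}\beta^\vee$, where $\mathcal E_w$ is Kostant's cascade of the root subsystem $R_w=\{\alpha\in R: w(\alpha)=-\alpha\}$ with positive roots $R_w^+=R_w\cap R^+$. That is, order $R_w^+$ by $\alpha\le\alpha'$ if $\alpha'-\alpha\in\sum_{\gamma\in R_w^+}\mathbf R_{\ge0}\,\gamma$ in $\mathbf R\otimes X$; let $\mathcal E_1$ be the set of maximal elements of $R_w^+$ and, for $i\ge2$, let $\mathcal E_i$ be the set of maximal elements of $\{\alpha\in R_w^+:\langle\alpha'^\vee,\alpha\rangle=0\text{ for all }\alpha'\in\mathcal E_1\cup\dots\cup\mathcal E_{i-1}\}$; then $\mathcal E_w=\bigcup_{i\ge1}\mathcal E_i$. -/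

import Mathlib

namespace InvolutionLift

variable {ι X Y : Type*} [AddCommGroup X] [AddCommGroup Y]

/-- The action of the Weyl group `W` on the cocharacter lattice `Y`, i.e. the action contragredient
to the action of `W` on the character lattice `X`. (Mathlib's `coweightHom` is the transpose of the
action on `X`, hence the inverse.) -/
noncomputable def coAct (P : RootPairing ι ℤ X Y) (w : P.weylGroup) : Y ≃ₗ[ℤ] Y :=
  (RootPairing.Equiv.coweightHom P (w : P.Aut)⁻¹).unop

/-- The simple reflection attached to a simple root, as an element of the Weyl group. -/
noncomputable def simpleRefl {P : RootPairing ι ℤ X Y} (b : P.Base) (i : b.support) :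
    P.weylGroup :=
  RootPairing.weylGroup.ofIdx P i

/-- The length `|w|`: the least number of factors in an expression of `w` as a product of simple
reflections. -/
noncomputable def length {P : RootPairing ι ℤ X Y} (b : P.Base) (w : P.weylGroup) : ℕ :=
  sInf {n | ∃ l : List b.support, l.length = n ∧ (l.map (simpleRefl b)).prod = w}

/-- The set `W₂` of all `w` in the Weyl group such that `w² = 1`. -/
def involutions (P : RootPairing ι ℤ X Y) : Set P.weylGroup := {w | w * w = 1}

/-- The coroot lattice: the subgroup `L` of `Y` generated by the simple coroots. -/
def corootLattice {P : RootPairing ι ℤ X Y} (b : P.Base) : AddSubgroup Y :=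
  AddSubgroup.closure (P.coroot '' b.support)

/-- The simple coroot attached to a simple root, as an element of `L`. -/
def simpleCoroot {P : RootPairing ι ℤ X Y} (b : P.Base) (i : b.support) : corootLattice b :=
  ⟨P.coroot i, AddSubgroup.subset_closure ⟨i, i.2, rfl⟩⟩

theorem one_mem_involutions (P : RootPairing ι ℤ X Y) : 1 ∈ involutions P :=
  mul_one 1

theorem simpleRefl_mul_self {P : RootPairing ι ℤ X Y} (b : P.Base) (i : b.support) :
    simpleRefl b i * simpleRefl b i = 1 :=
  Subtype.ext <| mul_eq_one_iff_inv_eq.2 (RootPairing.Equiv.reflection_inv P i)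

theorem simpleRefl_mem_involutions {P : RootPairing ι ℤ X Y} (b : P.Base) (i : b.support) :
    simpleRefl b i ∈ involutions P :=
  simpleRefl_mul_self b i

theorem conj_mem_involutions {P : RootPairing ι ℤ X Y} (b : P.Base) (i : b.support)
    (w : involutions P) :
    simpleRefl b i * w * simpleRefl b i ∈ involutions P := by
  have hs := simpleRefl_mul_self b i
  have hw : (w : P.weylGroup) * w = 1 := w.2
  change _ * _ = _
  calc simpleRefl b i * w * simpleRefl b i * (simpleRefl b i * w * simpleRefl b i)
      = simpleRefl b i * w * (simpleRefl b i * simpleRefl b i) * w * simpleRefl b i := by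
        simp only [mul_assoc]
    _ = simpleRefl b i * (w * w) * simpleRefl b i := by rw [hs]; simp only [mul_assoc, one_mul]
    _ = 1 := by rw [hw, mul_one, hs]

theorem mul_mem_involutions {P : RootPairing ι ℤ X Y} (b : P.Base) (i : b.support)
    (w : involutions P) (h : simpleRefl b i * w = w * simpleRefl b i) :
    simpleRefl b i * w ∈ involutions P := by
  have hs := simpleRefl_mul_self b i
  have hw : (w : P.weylGroup) * w = 1 := w.2
  change _ * _ = _
  calc simpleRefl b i * w * (simpleRefl b i * w)
      = simpleRefl b i * w * (w * simpleRefl b i) := by rw [h]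
    _ = simpleRefl b i * (w * w) * simpleRefl b i := by simp only [mul_assoc]
    _ = 1 := by rw [hw, mul_one, hs]

/-- The three properties that characterize the map `w ↦ r_w` from `W₂` to `L`. -/
structure IsInvolutionLift {P : RootPairing ι ℤ X Y} (b : P.Base)
    (r : involutions P → corootLattice b) : Prop where
  map_one : r ⟨1, one_mem_involutions P⟩ = 0
  map_simple (i : b.support) :
    r ⟨simpleRefl b i, simpleRefl_mem_involutions b i⟩ = simpleCoroot b i
  map_conj (w : involutions P) (i : b.support)
    (h : simpleRefl b i * w ≠ w * simpleRefl b i) :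
    coAct P (simpleRefl b i) (r w) =
      r ⟨simpleRefl b i * w * simpleRefl b i, conj_mem_involutions b i w⟩
  map_mul (w : involutions P) (i : b.support)
    (h : simpleRefl b i * w = w * simpleRefl b i) :
    ∃ n : ℤ, r ⟨simpleRefl b i * w, mul_mem_involutions b i w h⟩ = r w + n • simpleCoroot b i

/-- For a set `A` of (positive) roots: `α ≤ β` if `β - α` lies in the cone `∑_{γ ∈ A} ℝ≥0 γ` of the
real vector space `ℝ ⊗ X`. -/
def RootLE (P : RootPairing ι ℤ X Y) (A : Set ι) (i j : ι) : Prop :=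
  TensorProduct.tmul ℤ (1 : ℝ) (P.root j - P.root i) ∈
    PointedCone.hull ℝ ((fun k => TensorProduct.tmul ℤ (1 : ℝ) (P.root k)) '' A)

/-- The maximal elements of a set `B` of roots for the order defined by the positive roots `A`. -/
def maximalRoots (P : RootPairing ι ℤ X Y) (A B : Set ι) : Set ι :=
  {i ∈ B | ∀ j ∈ B, RootLE P A i j → j = i}

/-- The union `ℰ₁ ∪ ⋯ ∪ ℰₙ` of the first `n` steps of the cascade of the set `A` of positive roots:
`ℰₙ₊₁` is the set of maximal elements among the roots in `A` that are killed by the coroots of all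
elements of `ℰ₁ ∪ ⋯ ∪ ℰₙ`. -/
def cascadeUpTo (P : RootPairing ι ℤ X Y) (A : Set ι) : ℕ → Set ι
  | 0 => ∅
  | n + 1 => cascadeUpTo P A n ∪
      maximalRoots P A {i ∈ A | ∀ j ∈ cascadeUpTo P A n, P.pairing i j = 0}

/-- Kostant's cascade of the set `A` of positive roots. -/
def cascade (P : RootPairing ι ℤ X Y) (A : Set ι) : Set ι := ⋃ n, cascadeUpTo P A n

/-- The positive roots of the root subsystem `R_w` of all roots on which `w` acts as `-1`. -/
def posNegated {P : RootPairing ι ℤ X Y} (b : P.Base) (w : P.weylGroup) : Set ι :=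
  {i | b.IsPos i ∧ w • P.root i = -P.root i}

end InvolutionLift

open InvolutionLift

/-!
The lift is `r_w = ∑ β^∨`, the sum over Kostant's cascade of the roots negated by `w`.

A cascade is handled through the lists of `IsCascadeList`: choose a root `θ` of a positive subsystem
`A` such that the other roots of `A` pair to `0` or `1` with `θ^∨`, and go on with the roots
orthogonal to `θ`. Such lists exist (`IsPosSubsystem.exists_isCascadeList`). They enumerate the
cascade as defined through the order of `ℝ ⊗ X` (`IsCascadeList.cascade_eq`): the cone spanned by
`A` is lexicographically nonnegative with respect to the pairings with the successive members, so
that a member is maximal in its step, while any other root lies below the first member that it is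
not orthogonal to.

An involution that negates no root is trivial, hence every involution is the product of the
reflections in its cascade (`IsCascadeList.coAct_coroot`). For a root `a` negated by `w` this gives
`2 a^∨ = ∑ ⟨β, a⟩ β^∨`, the sum over the cascade. Here and below `⟨β, a⟩` is the pairing of the root
`β` with the coroot of `a`.

The main point is the behaviour of `r_w` under `w ↦ w s_a` for a simple root `a` negated by `w`.
The roots negated by `w s_a` are the roots negated by `w` that are orthogonal to `a`, and
`IsCascadeList.exists_perp` says that passing to these changes the sum over the cascade by a
multiple `n a^∨` with `n ∈ {-1, 0, 1}`. Let `θ` be the first cascade member. If `a = θ`, then `θ` is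
removed and `n = 1`; if `a` is orthogonal to `θ`, then `θ` is kept and the rest of the cascade is
treated recursively. Otherwise `⟨a, θ⟩ = 1`, and pairing the expansion of `2 a^∨` with `a` gives
`4 = ⟨θ, a⟩ + ∑ ⟨β, a⟩⟨a, β⟩`, where the sum runs over the other members. This leaves four
configurations: `⟨θ, a⟩ = 2` (type `C`, `n = 0`), and `⟨θ, a⟩ = 1` with the sum `3` split as `3`
(type `G₂`), `1 + 2` (type `B₃`) or `1 + 1 + 1` (simply laced), all with `n = -1`. In each of them
the new cascade is written down by applying reflections in `a` and in the members not orthogonal to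
`a`; that it is a cascade rests on `IsLinked.lead_eq` and `IsLinked.reflectionPerm_eq`.

Uniqueness (`IsInvolutionLift.eq`) is an induction on the length. If `w ≠ 1` has a descent that does
not commute with it, `r_w` is determined by a shorter conjugate. If not, each descent determines
`r_w` up to a multiple of its coroot; there are two descents unless `w` is a simple reflection, and
two simple coroots are linearly independent.
-/

namespace InvolutionLift

open RootPairing
open scoped TensorProduct

variable {ι X Y : Type*} [AddCommGroup X] [AddCommGroup Y] {P : RootPairing ι ℤ X Y}

/-! ### Pairings of reflected roots -/

theorem pairingIn_int (P : RootPairing ι ℤ X Y) (i j : ι) : P.pairingIn ℤ i j = P.pairing i j :=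
  P.algebraMap_pairingIn ℤ i j

theorem pairing_reflectionPerm_left (i j k : ι) :
    P.pairing (P.reflectionPerm j i) k = P.pairing i k - P.pairing i j * P.pairing j k := by
  rw [← root_coroot_eq_pairing, root_reflectionPerm, reflection_apply_root]; simp

theorem pairing_reflectionPerm_right (i j k : ι) :
    P.pairing k (P.reflectionPerm j i) = P.pairing k i - P.pairing j i * P.pairing k j := by
  rw [← root_coroot_eq_pairing, coroot_reflectionPerm, coreflection_apply_coroot]; simp

theorem coroot_reflect (i j : ι) :
    P.coroot (P.reflectionPerm j i) = P.coroot i - P.pairing j i • P.coroot j := by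
  rw [coroot_reflectionPerm, coreflection_apply_coroot]

theorem reflectionPerm_eq_comm {i j k : ι} :
    P.reflectionPerm j i = k ↔ i = P.reflectionPerm j k :=
  ⟨fun h => by rw [← h, reflectionPerm_self], fun h => by rw [h, reflectionPerm_self]⟩

theorem pairing_zero_symm {i j : ι} (h : P.pairing i j = 0) : P.pairing j i = 0 :=
  P.pairing_eq_zero_iff'.1 h

theorem pairing_pos_symm [Finite ι] {i j : ι} (h : 0 < P.pairing i j) : 0 < P.pairing j i := by
  rw [← pairingIn_int] at h ⊢
  exact (P.zero_lt_pairingIn_iff' ℤ).1 h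

theorem pairing_neg_symm [Finite ι] {i j : ι} (h : P.pairing i j < 0) : P.pairing j i < 0 := by
  rw [← pairingIn_int] at h ⊢
  exact (P.pairingIn_lt_zero_iff ℤ).1 h

/-- An invariant length function on the roots: it relates the pairings `⟨i, j⟩` and `⟨j, i⟩`. -/
theorem exists_length [Finite ι] (P : RootPairing ι ℤ X Y) :
    ∃ N : ι → ℤ, (∀ i, 0 < N i) ∧ (∀ i j, P.pairing j i * N i = P.pairing i j * N j) ∧
      ∀ i j, N (P.reflectionPerm i j) = N j := by
  have := Fintype.ofFinite ι
  have h (i : ι) : (P.posRootForm ℤ).rootLength i = P.RootForm (P.root i) (P.root i) :=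
    (P.posRootForm ℤ).algebraMap_rootLength i
  refine ⟨(P.posRootForm ℤ).rootLength, fun i => (P.posRootForm ℤ).rootLength_pos i,
    fun i j => ?_, fun i j => ?_⟩
  · simpa only [pairingIn_int] using (P.posRootForm ℤ).pairingIn_mul_eq_pairingIn_mul_swap i j
  · rw [h, h, root_reflectionPerm, P.rootForm_reflection_reflection_apply]

/-! ### Positive subsystems and cascades of orthogonal roots -/

/-- A set of positive roots which, together with its negative, is stable under the reflections in
its members: the set of positive roots of a root subsystem. -/
structure IsPosSubsystem (b : P.Base) (A : Set ι) : Prop where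
  pos : ∀ i ∈ A, b.IsPos i
  closed : ∀ i ∈ A, ∀ j ∈ A, P.reflectionPerm j i ∈ A ∨
    P.reflectionPerm (P.reflectionPerm j i) (P.reflectionPerm j i) ∈ A

/-- The members of `A` that are orthogonal to the root `j`. -/
def perp (P : RootPairing ι ℤ X Y) (A : Set ι) (j : ι) : Set ι := {i ∈ A | P.pairing i j = 0}

theorem mem_perp {A : Set ι} {i j : ι} : i ∈ perp P A j ↔ i ∈ A ∧ P.pairing i j = 0 := Iff.rfl

theorem perp_comm (A : Set ι) (i j : ι) : perp P (perp P A i) j = perp P (perp P A j) i := by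
  ext k; simp only [mem_perp]; tauto

/-- A list of roots obtained by repeatedly choosing a root `θ` of `A` such that all other members
of `A` pair to `0` or `1` with the coroot of `θ`, and passing to the members orthogonal to `θ`,
until nothing is left. It enumerates Kostant's cascade of `A`, see `IsCascadeList.cascade_eq`. -/
def IsCascadeList (P : RootPairing ι ℤ X Y) : Set ι → List ι → Prop
  | A, [] => A = ∅
  | A, θ :: l => θ ∈ A ∧ (∀ i ∈ A, i ≠ θ → P.pairing i θ = 0 ∨ P.pairing i θ = 1) ∧
      IsCascadeList P (perp P A θ) l

theorem IsPosSubsystem.perp {b : P.Base} {A : Set ι} (hA : IsPosSubsystem b A) (j : ι) :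
    IsPosSubsystem b (perp P A j) where
  pos i hi := hA.pos i hi.1
  closed i hi k hk := by
    have h : P.pairing (P.reflectionPerm k i) j = 0 := by
      rw [pairing_reflectionPerm_left, hi.2, hk.2]; ring
    refine (hA.closed i hi.1 k hk.1).imp (fun h' => ⟨h', h⟩) (fun h' => ⟨h', ?_⟩)
    rw [pairing_reflectionPerm_self_left, h, neg_zero]

namespace IsCascadeList

variable {A : Set ι} {l p q : List ι} {θ β : ι}

theorem mem (hl : IsCascadeList P A l) : ∀ i ∈ l, i ∈ A := by
  induction l generalizing A with
  | nil => simp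
  | cons θ l ih =>
    intro i hi
    rcases List.mem_cons.1 hi with rfl | hi
    · exact hl.1
    · exact (ih hl.2.2 i hi).1

theorem pairing_head (hl : IsCascadeList P A (θ :: l)) {i : ι} (hi : i ∈ l) :
    P.pairing i θ = 0 :=
  (hl.2.2.mem i hi).2

theorem pairing_head_nonneg (hl : IsCascadeList P A (θ :: l)) {i : ι} (hi : i ∈ A) :
    0 ≤ P.pairing i θ := by
  by_cases h : i = θ
  · rw [h, pairing_same]; decide
  · have := hl.2.1 i hi h; omega

theorem pairwise (hl : IsCascadeList P A l) : l.Pairwise fun i j => P.pairing i j = 0 := by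
  induction l generalizing A with
  | nil => exact List.Pairwise.nil
  | cons θ l ih =>
    exact List.Pairwise.cons (fun i hi => pairing_zero_symm (hl.pairing_head hi)) (ih hl.2.2)

theorem nodup (hl : IsCascadeList P A l) : l.Nodup :=
  hl.pairwise.imp fun {i j} h hij => by simp [hij] at h

theorem pairing_eq_zero (hl : IsCascadeList P A l) {i j : ι} (hi : i ∈ l) (hj : j ∈ l)
    (hij : i ≠ j) : P.pairing i j = 0 := by
  induction l generalizing A with
  | nil => simp at hi
  | cons θ l ih =>
    rcases List.mem_cons.1 hi with hi' | hi' <;> rcases List.mem_cons.1 hj with hj' | hj'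
    · exact absurd (hi'.trans hj'.symm) hij
    · exact hi' ▸ pairing_zero_symm (hl.pairing_head hj')
    · exact hj' ▸ hl.pairing_head hi'
    · exact ih hl.2.2 hi' hj'

/-- Dropping a member `β` from a cascade leaves a cascade of the roots orthogonal to `β`. -/
theorem erase (hl : IsCascadeList P A (p ++ β :: q)) :
    IsCascadeList P (perp P A β) (p ++ q) := by
  induction p generalizing A with
  | nil => exact hl.2.2
  | cons θ p ih =>
    refine ⟨⟨hl.1, pairing_zero_symm (hl.pairing_head (by simp))⟩,
      fun i hi h => hl.2.1 i hi.1 h, ?_⟩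
    rw [perp_comm]
    exact ih hl.2.2

/-- A root of `A` orthogonal to all cascade members before `β` pairs to `0` or `1` with `β`. -/
theorem pairing_eq_zero_or_one (hl : IsCascadeList P A (p ++ β :: q)) {i : ι} (hi : i ∈ A)
    (hp : ∀ j ∈ p, P.pairing i j = 0) : i = β ∨ P.pairing i β = 0 ∨ P.pairing i β = 1 := by
  induction p generalizing A with
  | nil => exact or_iff_not_imp_left.2 (hl.2.1 i hi)
  | cons θ p ih =>
    exact ih hl.2.2 ⟨hi, hp θ (by simp)⟩ fun j hj => hp j (by simp [hj])

/-- If two roots of `A` have opposite pairings with the first members of a cascade, then these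
pairings vanish. -/
theorem pairing_eq_zero_of_neg (hl : IsCascadeList P A (p ++ q)) {i j : ι} (hi : i ∈ A)
    (hj : j ∈ A) (hp : ∀ k ∈ p, P.pairing j k = -P.pairing i k) :
    ∀ k ∈ p, P.pairing i k = 0 := by
  induction p generalizing A with
  | nil => simp
  | cons θ p ih =>
    have h0 : P.pairing i θ = 0 := by
      have h1 := hl.pairing_head_nonneg hi
      have h2 := hl.pairing_head_nonneg hj
      have h3 := hp θ (by simp)
      omega
    have h0' : P.pairing j θ = 0 := by rw [hp θ (by simp), h0, neg_zero]
    intro k hk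
    rcases List.mem_cons.1 hk with rfl | hk
    · exact h0
    · exact ih hl.2.2 ⟨hi, h0⟩ ⟨hj, h0'⟩ (fun k hk => hp k (by simp [hk])) k hk

/-- Every root of `A` is detected by the cascade; the first member that it is not orthogonal to is
either the root itself or pairs to `1` with it. -/
theorem exists_lead (hl : IsCascadeList P A l) {i : ι} (hi : i ∈ A) :
    ∃ p β q, l = p ++ β :: q ∧ (∀ j ∈ p, P.pairing i j = 0) ∧ (i = β ∨ P.pairing i β = 1) := by
  induction l generalizing A with
  | nil => exact absurd hi (by rw [show A = ∅ from hl]; simp)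
  | cons θ l ih =>
    by_cases h : P.pairing i θ = 0
    · obtain ⟨p, β, q, rfl, hp, hβ⟩ := ih hl.2.2 ⟨hi, h⟩
      refine ⟨θ :: p, β, q, rfl, fun j hj => ?_, hβ⟩
      rcases List.mem_cons.1 hj with rfl | hj
      · exact h
      · exact hp j hj
    · refine ⟨[], θ, l, rfl, by simp, ?_⟩
      by_cases h' : i = θ
      · exact Or.inl h'
      · exact Or.inr ((hl.2.1 i hi h').resolve_left h)

end IsCascadeList

namespace IsPosSubsystem

variable {b : P.Base} {A : Set ι}

theorem neg_notMem (hA : IsPosSubsystem b A) {i : ι} (hi : i ∈ A) : P.reflectionPerm i i ∉ A := by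
  intro h
  have h1 : 0 < b.height i := hA.pos i hi
  have h2 : 0 < b.height (P.reflectionPerm i i) := hA.pos _ h
  have h3 : b.height (P.reflectionPerm i i) = -b.height i := b.height_reflectionPerm_self i
  omega

/-- A reflected root whose pairing with the head of a cascade is positive is again positive. -/
theorem reflectionPerm_mem (hA : IsPosSubsystem b A) {θ : ι} {l : List ι}
    (hl : IsCascadeList P A (θ :: l)) {i j : ι} (hi : i ∈ A) (hj : j ∈ A)
    (h : 0 < P.pairing (P.reflectionPerm j i) θ) : P.reflectionPerm j i ∈ A := by
  refine (hA.closed i hi j hj).resolve_right fun h' => ?_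
  have := hl.pairing_head_nonneg h'
  rw [pairing_reflectionPerm_self_left] at this
  omega

/-- Every positive subsystem has a cascade: a root which is highest among the roots of maximal
length can serve as its first member. -/
theorem exists_isCascadeList [Finite ι] [P.IsReduced] (hA : IsPosSubsystem b A) :
    ∃ l, IsCascadeList P A l := by
  induction hn : A.ncard using Nat.strong_induction_on generalizing A with
  | _ n ih =>
  rcases A.eq_empty_or_nonempty with h0 | h0
  · exact ⟨[], h0⟩
  obtain ⟨N, hN, hswap, hinv⟩ := exists_length P
  obtain ⟨θ, hθ, hmax⟩ := A.toFinite.exists_maximalFor (fun i => toLex (N i, b.height i)) A h0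
  have hlen : ∀ i ∈ A, N i ≤ N θ := by
    intro i hi
    by_contra! hlt
    have := hmax hi (Prod.Lex.toLex_le_toLex.2 (Or.inl hlt))
    rcases Prod.Lex.toLex_le_toLex.1 this with h | h
    · exact absurd h (by dsimp only; omega)
    · exact absurd h.1 (by dsimp only; omega)
  have hht : ∀ i ∈ A, N i = N θ → b.height i ≤ b.height θ := by
    intro i hi he
    by_contra! hlt
    have := hmax hi (Prod.Lex.toLex_le_toLex.2 (Or.inr ⟨he.symm, hlt.le⟩))
    rcases Prod.Lex.toLex_le_toLex.1 this with h | h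
    · exact absurd h (by dsimp only; omega)
    · exact absurd h.2 (by dsimp only; omega)
  have hpair : ∀ i ∈ A, i ≠ θ → P.pairing i θ = 0 ∨ P.pairing i θ = 1 := by
    intro i hi hne
    have hne' : P.root i ≠ -P.root θ := by
      intro h
      have : i = P.reflectionPerm θ θ := P.root.injective (by simpa using h)
      exact hA.neg_notMem hθ (this ▸ hi)
    have hmem := P.pairingIn_pairingIn_mem_set_of_isCrystal_of_isRed' i θ
      (fun h => hne (P.root.injective h)) hne'
    simp only [pairingIn_int, Set.mem_insert_iff, Set.mem_singleton_iff, Prod.mk.injEq] at hmem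
    have h1 := hswap i θ
    have h2 := hlen i hi
    have h3 := hN i
    have h4 := hN θ
    have hle : P.pairing i θ = 0 ∨ P.pairing i θ = 1 ∨
        (P.pairing i θ < 0 ∧ P.pairing θ i < 0 ) := by
      rcases hmem with h | h | h | h | h | h | h | h | h | h | h <;>
        rw [h.1, h.2] at h1 <;> omega
    refine hle.imp_right fun h => h.resolve_right fun h => ?_
    -- the reflection of `θ` in `i` would be a higher root of the same length
    have hr : P.root (P.reflectionPerm i θ) = P.root θ + (-P.pairing θ i) • P.root i := by
      rw [root_reflectionPerm, reflection_apply_root, neg_smul, sub_eq_add_neg]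
    have hhr := b.height_add_zsmul hr
    have hi0 : 0 < b.height i := hA.pos i hi
    have hθ0 : 0 < b.height θ := hA.pos θ hθ
    have hgt : b.height θ < b.height (P.reflectionPerm i θ) := by
      rw [hhr, smul_eq_mul]; nlinarith
    have hmem' : P.reflectionPerm i θ ∈ A := by
      refine (hA.closed θ hθ i hi).resolve_right fun h' => ?_
      have h5 : 0 < b.height _ := hA.pos _ h'
      have h6 := b.height_reflectionPerm_self (P.reflectionPerm i θ)
      simp only [indexNeg_neg] at h6
      omega
    exact absurd (hht _ hmem' (hinv i θ)) (by omega)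
  obtain ⟨l, hl⟩ := ih _ (by
    rw [← hn]
    refine Set.ncard_lt_ncard ⟨fun i hi => hi.1, fun h => ?_⟩
    have := (h hθ).2
    simp at this) (hA.perp θ) rfl
  exact ⟨θ :: l, hθ, hpair, hl⟩

end IsPosSubsystem

/-! ### Removing a simple root from a cascade -/

/-- The setting in which a simple root `a` of a positive subsystem `A` is not orthogonal to the
first member `θ ≠ a` of a cascade `θ :: l` of `A`. The last hypothesis says that `-1` is in the
Weyl group of the subsystem, expressed through the cascade. -/
structure IsLinked (b : P.Base) (A : Set ι) (θ : ι) (l : List ι) (a : ι) : Prop where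
  sub : IsPosSubsystem b A
  casc : IsCascadeList P A (θ :: l)
  mem : a ∈ A
  simple : ∀ i ∈ A, i ≠ a → P.reflectionPerm a i ∈ A
  pairing : P.pairing a θ = 1
  two_smul : (2 : ℤ) • P.coroot a =
    P.pairing θ a • P.coroot θ + (l.map fun β => P.pairing β a • P.coroot β).sum

namespace IsLinked

variable {b : P.Base} {A : Set ι} {θ a : ι} {l : List ι}

theorem head_mem (h : IsLinked b A θ l a) : θ ∈ A := h.casc.1

theorem ne_of_mem (h : IsLinked b A θ l a) {i : ι} (hi : P.pairing i θ ≠ 1) : i ≠ a :=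
  fun hia => hi (hia ▸ h.pairing)

theorem pairing_head_cases (h : IsLinked b A θ l a) {i : ι} (hi : i ∈ A) (hθ : i ≠ θ) :
    P.pairing i θ = 0 ∨ P.pairing i θ = 1 := h.casc.2.1 i hi hθ

theorem pairing_le (h : IsLinked b A θ l a) {i : ι} (hi : i ∈ A) (hia : i ≠ a) :
    P.pairing i a ≤ P.pairing i θ := by
  have h1 := h.casc.pairing_head_nonneg (h.simple i hi hia)
  rw [pairing_reflectionPerm_left, h.pairing] at h1
  linarith

theorem mem_of_mem (h : IsLinked b A θ l a) {i : ι} (hi : i ∈ l) : i ∈ A := (h.casc.2.2.mem i hi).1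

theorem pairing_head_eq_zero (h : IsLinked b A θ l a) {i : ι} (hi : i ∈ l) :
    P.pairing i θ = 0 := h.casc.pairing_head hi

theorem pairing_nonpos (h : IsLinked b A θ l a) {i : ι} (hi : i ∈ l) : P.pairing i a ≤ 0 := by
  have h0 := h.pairing_head_eq_zero hi
  exact h0 ▸ h.pairing_le (h.mem_of_mem hi) (h.ne_of_mem (by rw [h0]; decide))

/-- A root `γ` orthogonal to `θ`, for which the reflection of `γ` in the cascade member `β` would be
moved by `a` to a negative root, must have `β` as its leading cascade member. -/
theorem lead_eq (h : IsLinked b A θ l a) {p q : List ι} {β γ : ι} (hl : l = p ++ β :: q)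
    (hγ : γ ∈ A) (hγθ : P.pairing γ θ = 0)
    (hpos : 0 < P.pairing γ a - P.pairing γ β * P.pairing β a) (hγβ : 0 < P.pairing γ β) :
    (γ = β ∨ P.pairing γ β = 1) ∧ ∀ i ∈ p, P.pairing γ i = 0 := by
  have hβ : β ∈ l := by simp [hl]
  have hβθ := h.pairing_head_eq_zero hβ
  have hc := h.casc.2.2
  rw [hl] at hc
  -- `δ = s_β γ` is negative, and `-δ` and `γ` have opposite pairings with the members before `β`
  set δ := P.reflectionPerm β γ with hδ
  have hδθ : P.pairing δ θ = 0 := by rw [hδ, pairing_reflectionPerm_left, hγθ, hβθ]; ring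
  have hδa : P.pairing δ a = P.pairing γ a - P.pairing γ β * P.pairing β a := by
    rw [hδ, pairing_reflectionPerm_left]
  have hδA : P.reflectionPerm δ δ ∈ A := by
    refine (h.sub.closed γ hγ β (h.mem_of_mem hβ)).resolve_left fun (hδA : δ ∈ A) => ?_
    have := h.pairing_le hδA (h.ne_of_mem (by rw [hδθ]; decide))
    omega
  have hp : ∀ i ∈ p, P.pairing γ i = 0 := by
    refine hc.pairing_eq_zero_of_neg (j := P.reflectionPerm δ δ) ⟨hγ, hγθ⟩ ⟨hδA, ?_⟩ fun i hi => ?_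
    · rw [pairing_reflectionPerm_self_left, hδθ, neg_zero]
    · have : P.pairing β i = 0 := by
        refine hc.pairing_eq_zero (by simp) (by simp [hi]) ?_
        rintro rfl
        have := hc.nodup
        simp only [List.nodup_append, List.mem_cons] at this
        exact this.2.2 β hi β (Or.inl rfl) rfl
      rw [pairing_reflectionPerm_self_left, hδ, pairing_reflectionPerm_left, this, mul_zero,
        sub_zero]
  refine ⟨?_, hp⟩
  rcases hc.pairing_eq_zero_or_one ⟨hγ, hγθ⟩ hp with h1 | h1 | h1
  · exact Or.inl h1
  · omega
  · exact Or.inr h1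

/-- If `γ` pairs to `1` with `θ`, and reflecting it in a cascade member `β` makes its pairing
with `a` at least `2`, then the reflected root is `a`. -/
theorem reflectionPerm_eq (h : IsLinked b A θ l a) {β γ : ι} (hβ : β ∈ l) (hγ : γ ∈ A)
    (hγθ : P.pairing γ θ = 1) (h2 : 2 ≤ P.pairing γ a - P.pairing γ β * P.pairing β a) :
    P.reflectionPerm β γ = a := by
  have hβθ := h.pairing_head_eq_zero hβ
  have hδθ : P.pairing (P.reflectionPerm β γ) θ = 1 := by
    rw [pairing_reflectionPerm_left, hγθ, hβθ]; ring
  by_contra hne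
  have := h.pairing_le (h.sub.reflectionPerm_mem h.casc hγ (h.mem_of_mem hβ) (by omega)) hne
  rw [hδθ, pairing_reflectionPerm_left] at this
  omega

theorem reflectionPerm_mem (h : IsLinked b A θ l a) {β γ : ι} (hβ : β ∈ l) (hγ : γ ∈ A)
    (hγθ : P.pairing γ θ = 1) :
    P.reflectionPerm β γ ∈ A ∧ P.pairing (P.reflectionPerm β γ) θ = 1 := by
  have hδθ : P.pairing (P.reflectionPerm β γ) θ = 1 := by
    rw [pairing_reflectionPerm_left, hγθ, h.pairing_head_eq_zero hβ]; ring
  exact ⟨h.sub.reflectionPerm_mem h.casc hγ (h.mem_of_mem hβ) (by omega), hδθ⟩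

theorem abs_pairing_le_one (h : IsLinked b A θ l a) {β γ : ι} (hβ : β ∈ l)
    (hβa : P.pairing β a = -1) (haβ : P.pairing a β ≠ -2) (hγ : γ ∈ A)
    (hγθ : P.pairing γ θ = 1) (hγa : P.pairing γ a = 0) :
    -1 ≤ P.pairing γ β ∧ P.pairing γ β ≤ 1 := by
  constructor
  · by_contra! hlt
    obtain ⟨h1, h2⟩ := h.reflectionPerm_mem hβ hγ hγθ
    have h3 : P.pairing (P.reflectionPerm β γ) a = P.pairing γ β := by
      rw [pairing_reflectionPerm_left, hγa, hβa]; ring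
    have h4 := h.simple _ h1 (by rintro h4; rw [h4, pairing_same] at h3; omega)
    have h5 : P.pairing (P.reflectionPerm a (P.reflectionPerm β γ)) θ = 1 - P.pairing γ β := by
      rw [pairing_reflectionPerm_left, h2, h3, h.pairing]; ring
    by_cases h6 : P.reflectionPerm a (P.reflectionPerm β γ) = θ
    · rw [h6, pairing_same] at h5; omega
    · have := h.pairing_head_cases h4 h6; omega
  · by_contra! hlt
    have h1 := h.reflectionPerm_eq hβ hγ hγθ (by rw [hγa, hβa]; omega)
    rw [reflectionPerm_eq_comm] at h1
    rw [h1, pairing_reflectionPerm_left, pairing_same, hβa] at hγa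
    omega

theorem one_le_pairing [Finite ι] (h : IsLinked b A θ l a) : 1 ≤ P.pairing θ a :=
  pairing_pos_symm (by rw [h.pairing]; decide)

theorem head_ne (h : IsLinked b A θ l a) : θ ≠ a := h.ne_of_mem (by rw [pairing_same]; decide)

theorem pairing_le_two (h : IsLinked b A θ l a) : P.pairing θ a ≤ 2 := by
  simpa using h.pairing_le h.head_mem h.head_ne

/-- The pairing of the cascade expansion of `2 a^∨` with `a`. -/
theorem sum_pairing (h : IsLinked b A θ l a) :
    (l.map fun β => P.pairing β a * P.pairing a β).sum = 4 - P.pairing θ a := by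
  have h1 := congrArg (P.toLinearMap (P.root a)) h.two_smul
  simp only [map_add, map_smul, root_coroot_eq_pairing, pairing_same, h.pairing, smul_eq_mul,
    map_list_sum, List.map_map, Function.comp_def] at h1
  linarith

/-- In the doubly laced case `⟨θ, a⟩ = 2`, the reflection of `θ` in `a` is a cascade member. -/
theorem exists_of_pairing_eq_two [Finite ι] (h : IsLinked b A θ l a) (h2 : P.pairing θ a = 2) :
    P.reflectionPerm a θ ∈ l := by
  have hσ := h.simple θ h.head_mem h.head_ne
  have hσθ : P.pairing (P.reflectionPerm a θ) θ = 0 := by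
    rw [pairing_reflectionPerm_left, h2, h.pairing, pairing_same]; ring
  obtain ⟨p, β, q, hl, hp, hβ⟩ := h.casc.2.2.exists_lead ⟨hσ, hσθ⟩
  rcases hβ with hβ | hβ
  · simp [hl, hβ]
  · -- the pairings of `s_a θ` with the cascade members other than `θ` are even
    rw [pairing_reflectionPerm_left, h2,
      pairing_zero_symm (h.pairing_head_eq_zero (i := β) (by simp [hl]))] at hβ
    omega

/-- If `a` and `θ` have the same length, so that `⟨θ, a⟩ = 1`, then no cascade member `β ≠ θ` is
longer than `a`. -/
theorem neg_one_le_pairing (h : IsLinked b A θ l a) (h1 : P.pairing θ a = 1) {β : ι}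
    (hβ : β ∈ l) : -1 ≤ P.pairing β a := by
  by_contra! hlt
  have hβθ := h.pairing_head_eq_zero hβ
  have h2 := h.simple β (h.mem_of_mem hβ) (h.ne_of_mem (by rw [hβθ]; decide))
  have h3 : P.pairing (P.reflectionPerm a β) θ = -P.pairing β a := by
    rw [pairing_reflectionPerm_left, hβθ, h.pairing]; ring
  have h4 : P.pairing (P.reflectionPerm a β) a = -P.pairing β a := by
    rw [pairing_reflectionPerm_left, pairing_same]; ring
  by_cases h5 : P.reflectionPerm a β = θ
  · rw [h5, h1] at h4; omega
  · have := h.pairing_head_cases h2 h5; omega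

end IsLinked

/-- Splits off the first cascade member which is not orthogonal to `a`. -/
theorem exists_split [Finite ι] {a : ι} (l : List ι) (hl : ∀ β ∈ l, P.pairing β a ≤ 0) :
    (∀ β ∈ l, P.pairing β a = 0) ∨ ∃ p β q, l = p ++ β :: q ∧ (∀ i ∈ p, P.pairing i a = 0) ∧
      P.pairing β a < 0 ∧ P.pairing a β < 0 := by
  induction l with
  | nil => simp
  | cons x l ih =>
    by_cases hx : P.pairing x a = 0
    · rcases ih fun β hβ => hl β (by simp [hβ]) with h | ⟨p, β, q, rfl, hp, hβ⟩
      · left; simpa [hx] using h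
      · exact Or.inr ⟨x :: p, β, q, rfl, by simpa [hx] using hp, hβ⟩
    · have : P.pairing x a < 0 := lt_of_le_of_ne (hl x (by simp)) hx
      exact Or.inr ⟨[], x, l, rfl, by simp, this, pairing_neg_symm this⟩

theorem sum_pairing_nonneg [Finite ι] {a : ι} (l : List ι) (hl : ∀ β ∈ l, P.pairing β a ≤ 0) :
    0 ≤ (l.map fun β => P.pairing β a * P.pairing a β).sum := by
  refine List.sum_nonneg fun x hx => ?_
  obtain ⟨β, hβ, rfl⟩ := List.mem_map.1 hx
  rcases (hl β hβ).eq_or_lt with h | h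
  · simp [h]
  · exact (mul_pos_of_neg_of_neg h (pairing_neg_symm h)).le

theorem sum_map_eq_zero {M : Type*} [AddMonoid M] {f : ι → M} {l : List ι}
    (h : ∀ i ∈ l, f i = 0) : (l.map f).sum = 0 :=
  List.sum_eq_zero fun x hx => by
    obtain ⟨i, hi, rfl⟩ := List.mem_map.1 hx
    exact h i hi

/-! ### Cascades of the roots orthogonal to a simple root -/

/-- `n` is an admissible coefficient in the comparison of two cascades: it is `-1`, `0` or `1`, and
`0` only occurs if there are roots of different lengths. -/
def IsCoeff (P : RootPairing ι ℤ X Y) (n : ℤ) : Prop :=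
  (n = -1 ∨ n = 0 ∨ n = 1) ∧ (n = 0 → ∃ i j, P.pairing i j ≠ P.pairing j i)

theorem isCoeff_one : IsCoeff P 1 := ⟨by simp, by simp⟩

theorem isCoeff_neg_one : IsCoeff P (-1) := ⟨by simp, by simp⟩

namespace IsLinked

variable {b : P.Base} {A : Set ι} {θ a : ι} {l : List ι}

/-- The case that `θ` is longer than `a`, as in type `C`: the members `θ` and `β = s_a θ` are
replaced by `s_β a`. -/
theorem exists_of_eq_two [Finite ι] (h : IsLinked b A θ l a) (h2 : P.pairing θ a = 2) :
    ∃ l', IsCascadeList P (perp P A a) l' ∧ ∃ n, IsCoeff P n ∧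
      ((θ :: l).map P.coroot).sum = (l'.map P.coroot).sum + n • P.coroot a := by
  obtain ⟨β, hβ⟩ : ∃ β, P.reflectionPerm a θ = β := ⟨_, rfl⟩
  have hβl : β ∈ l := hβ ▸ h.exists_of_pairing_eq_two h2
  have hcβ : P.coroot β = P.coroot θ - P.coroot a := by
    rw [← hβ, coroot_reflect, h.pairing, one_smul]
  have hpβ (i : ι) : P.pairing i β = P.pairing i θ - P.pairing i a := by
    simp only [← root_coroot_eq_pairing, hcβ, map_sub]
  have haβ : P.pairing a β = -1 := by rw [hpβ, h.pairing, pairing_same]; norm_num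
  have hβa : P.pairing β a = -2 := by
    rw [← hβ, pairing_reflectionPerm_left, pairing_same, h2]; norm_num
  have hβθ := h.pairing_head_eq_zero hβl
  have hβA := h.mem_of_mem hβl
  obtain ⟨p, q, rfl⟩ := List.append_of_mem hβl
  obtain ⟨φ, hφ⟩ : ∃ φ, P.reflectionPerm β a = φ := ⟨_, rfl⟩
  have hcφ : P.coroot φ = P.coroot a + (2 : ℤ) • P.coroot β := by
    rw [← hφ, coroot_reflect, hβa]; module
  have hpφ (i : ι) : P.pairing i φ = P.pairing i a + 2 * P.pairing i β := by
    simp only [← root_coroot_eq_pairing, hcφ, map_add, map_smul, smul_eq_mul]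
  refine ⟨φ :: (p ++ q), ⟨⟨?_, ?_⟩, fun γ hγ hne => Or.inl ?_, ?_⟩, 0,
    ⟨by simp, fun _ => ⟨a, β, by rw [haβ, hβa]; decide⟩⟩, ?_⟩
  · exact hφ ▸ (h.reflectionPerm_mem hβl h.mem h.pairing).1
  · rw [← hφ, pairing_reflectionPerm_left, pairing_same, haβ, hβa]; norm_num
  · have h3 : P.pairing γ β = P.pairing γ θ := by rw [hpβ, hγ.2, sub_zero]
    have h4 : P.pairing γ θ ≠ 1 := fun h4 => hne <| by
      rw [← hφ, ← reflectionPerm_eq_comm]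
      exact h.reflectionPerm_eq hβl hγ.1 h4 (by rw [hγ.2, h3, h4, hβa]; norm_num)
    have h5 : γ ≠ θ := by
      rintro rfl
      rw [pairing_same, pairing_zero_symm hβθ] at h3
      norm_num at h3
    rw [hpφ, hγ.2, h3, (h.pairing_head_cases hγ.1 h5).resolve_right h4]; norm_num
  · convert h.casc.2.2.erase using 1
    ext i
    simp only [mem_perp, hpφ]
    have := hpβ i
    constructor <;> rintro ⟨⟨h3, h4⟩, h5⟩ <;> refine ⟨⟨h3, ?_⟩, ?_⟩ <;> omega
  · simp only [List.map_cons, List.map_append, List.sum_cons, List.sum_append, hcφ, hcβ]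
    module

/-- The case of type `G₂`: the members `θ` and `β` are replaced by `s_β s_a β`. -/
theorem exists_of_neg_three [Finite ι] (h : IsLinked b A θ l a) {p q : List ι} {β : ι}
    (hl : l = p ++ β :: q) (hβa : P.pairing β a = -1) (haβ : P.pairing a β = -3)
    (h2 : (2 : ℤ) • P.coroot a = P.coroot θ - P.coroot β) :
    ∃ l', IsCascadeList P (perp P A a) l' ∧ ∃ n, IsCoeff P n ∧
      ((θ :: l).map P.coroot).sum = (l'.map P.coroot).sum + n • P.coroot a := by
  subst hl
  have hβl : β ∈ p ++ β :: q := by simp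
  have hβθ := h.pairing_head_eq_zero hβl
  have hβA := h.mem_of_mem hβl
  have hp2 (i : ι) : 2 * P.pairing i a = P.pairing i θ - P.pairing i β := by
    simpa only [← root_coroot_eq_pairing, map_sub, map_smul, smul_eq_mul] using
      congrArg (P.toLinearMap (P.root i)) h2
  obtain ⟨φ, hφ⟩ : ∃ φ, P.reflectionPerm β (P.reflectionPerm a β) = φ := ⟨_, rfl⟩
  have hcφ : P.coroot φ = (3 : ℤ) • P.coroot a + (2 : ℤ) • P.coroot β := by
    rw [← hφ, coroot_reflect, coroot_reflect, pairing_reflectionPerm_right,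
      pairing_same, hβa, haβ]; module
  have hpφ (i : ι) : P.pairing i φ = 3 * P.pairing i a + 2 * P.pairing i β := by
    simp only [← root_coroot_eq_pairing, hcφ, map_add, map_smul, smul_eq_mul]
  have haβA : P.reflectionPerm a β ∈ A := h.simple β hβA (h.ne_of_mem (by rw [hβθ]; decide))
  have haβθ : P.pairing (P.reflectionPerm a β) θ = 1 := by
    rw [pairing_reflectionPerm_left, hβθ, hβa, h.pairing]; norm_num
  refine ⟨φ :: (p ++ q), ⟨⟨?_, ?_⟩, fun γ hγ hne => Or.inl ?_, ?_⟩, -1, isCoeff_neg_one, ?_⟩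
  · exact hφ ▸ (h.reflectionPerm_mem hβl haβA haβθ).1
  · rw [← hφ, pairing_reflectionPerm_left, pairing_reflectionPerm_left,
      pairing_reflectionPerm_left, pairing_same, pairing_same, haβ, hβa]; norm_num
  · have h3 : P.pairing γ θ = P.pairing γ β := by linarith [hp2 γ, hγ.2]
    have h4 : P.pairing γ θ ≠ 1 := fun h4 => hne <| by
      obtain ⟨h5, h6⟩ := h.reflectionPerm_mem hβl hγ.1 h4
      have h7 : P.pairing (P.reflectionPerm β γ) a = 1 := by
        rw [pairing_reflectionPerm_left, hγ.2, ← h3, h4, hβa]; norm_num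
      -- `ε = s_a s_β γ` pairs to `2` with `β`, which forces `ε = β`
      obtain ⟨ε, hε⟩ : ∃ ε, P.reflectionPerm a (P.reflectionPerm β γ) = ε := ⟨_, rfl⟩
      have hεA : ε ∈ A := by
        refine hε ▸ h.simple _ h5 fun h8 => ?_
        rw [h8, pairing_same] at h7; norm_num at h7
      have hεθ : P.pairing ε θ = 0 := by
        rw [← hε, pairing_reflectionPerm_left, h6, h7, h.pairing]; norm_num
      have hεa : P.pairing ε a = -1 := by
        rw [← hε, pairing_reflectionPerm_left, h7, pairing_same]; norm_num
      have hεβ : P.pairing ε β = 2 := by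
        rw [← hε, pairing_reflectionPerm_left, h7, haβ, pairing_reflectionPerm_left, ← h3, h4,
          pairing_same]; norm_num
      have := (h.lead_eq rfl hεA hεθ (by rw [hεa, hεβ, hβa]; norm_num)
        (by rw [hεβ]; norm_num)).1.resolve_right (by rw [hεβ]; norm_num)
      rw [← hφ, ← reflectionPerm_eq_comm, ← reflectionPerm_eq_comm, hε, this]
    have h5 : γ ≠ θ := by
      rintro rfl
      rw [pairing_same, pairing_zero_symm hβθ] at h3
      norm_num at h3
    rw [hpφ, hγ.2, ← h3, (h.pairing_head_cases hγ.1 h5).resolve_right h4]; norm_num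
  · convert h.casc.2.2.erase using 1
    ext i
    simp only [mem_perp, hpφ]
    have := hp2 i
    constructor <;> rintro ⟨⟨h3, h4⟩, h5⟩ <;> refine ⟨⟨h3, ?_⟩, ?_⟩ <;> omega
  · have h3 : P.coroot θ = (2 : ℤ) • P.coroot a + P.coroot β := by rw [h2]; module
    simp only [List.map_cons, List.map_append, List.sum_cons, List.sum_append, hcφ, h3]
    module

/-- A root orthogonal to `θ` and `a` whose leading cascade member is a short one cannot be linked to
a long one. -/
theorem pairing_ne_neg_one [Finite ι] (h : IsLinked b A θ l a) {β β' γ : ι} (hβ : β ∈ l)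
    (hβ' : β' ∈ l) (hβa : P.pairing β a = -1) (haβ : P.pairing a β = -1)
    (hβa' : P.pairing β' a = -1) (haβ' : P.pairing a β' = -2) (hγ : γ ∈ A)
    (hγθ : P.pairing γ θ = 0) (hγa : P.pairing γ a = 0) (hγβ' : 0 < P.pairing γ β') :
    P.pairing γ β ≠ -1 := by
  intro hγβ
  obtain ⟨p, q, rfl⟩ := List.append_of_mem hβ'
  have hββ' : P.pairing β β' = 0 := by
    refine h.casc.2.2.pairing_eq_zero hβ hβ' ?_
    rintro rfl; omega
  have hne : γ ≠ β' := by rintro rfl; omega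
  obtain ⟨h1, hp⟩ := h.lead_eq rfl hγ hγθ (by rw [hγa, hβa']; omega) hγβ'
  replace h1 := h1.resolve_left hne
  obtain ⟨N, hN, hswap, -⟩ := exists_length P
  have e1 := hswap β' γ
  have e2 := hswap a β'
  have e3 := hswap a β
  have e4 := hswap γ β
  rw [h1] at e1
  rw [haβ', hβa'] at e2
  rw [haβ, hβa] at e3
  rw [hγβ] at e4
  -- `β` is twice as long as `β'`
  have hx : P.pairing β γ = -2 * P.pairing β' γ := by
    apply mul_right_cancel₀ (hN γ).ne'
    linarith
  have hy : 0 < P.pairing β' γ := pairing_pos_symm hγβ'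
  -- the reflection of `β` in `γ` pairs to at least `2` with the leading cascade member `β'` of `γ`
  obtain ⟨δ, hδ⟩ : ∃ δ, P.reflectionPerm γ β = δ := ⟨_, rfl⟩
  have hβθ := h.pairing_head_eq_zero hβ
  have hδβ' : P.pairing δ β' = - P.pairing β γ := by
    rw [← hδ, pairing_reflectionPerm_left, hββ', h1]; ring
  have hδθ : P.pairing δ θ = 0 := by rw [← hδ, pairing_reflectionPerm_left, hβθ, hγθ]; ring
  have hne' : β ∉ p := fun hp' => by have := hp β hp'; omega
  have hδp : ∀ i ∈ p, P.pairing δ i = 0 := fun i hi => by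
    rw [← hδ, pairing_reflectionPerm_left, hp i hi, h.casc.2.2.pairing_eq_zero hβ (by simp [hi])
      (fun h' => hne' (h' ▸ hi))]; ring
  have hδA : δ ∈ A := by
    refine hδ ▸ (h.sub.closed β (h.mem_of_mem hβ) γ hγ).resolve_right fun h' => ?_
    rw [hδ] at h'
    have h3 : P.pairing (P.reflectionPerm δ δ) β' = P.pairing β γ := by
      rw [pairing_reflectionPerm_self_left, hδβ']; ring
    rcases h.casc.2.2.pairing_eq_zero_or_one (i := P.reflectionPerm δ δ)
      ⟨h', by rw [pairing_reflectionPerm_self_left, hδθ, neg_zero]⟩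
      (fun i hi => by rw [pairing_reflectionPerm_self_left, hδp i hi, neg_zero]) with h4 | h4 | h4
    · rw [h4, pairing_same] at h3; omega
    · omega
    · omega
  rcases h.casc.2.2.pairing_eq_zero_or_one ⟨hδA, hδθ⟩ hδp with h4 | h4 | h4
  · have h5 : P.pairing a δ = -1 := by
      rw [← hδ, pairing_reflectionPerm_right, haβ, pairing_zero_symm hγa]; ring
    rw [h4] at h5; omega
  · omega
  · omega

/-- The case of type `B₃`: the members `θ`, `β` and `β'` are replaced by `s_β s_a β'` and
`s_β' a`. -/
theorem exists_of_neg_one_neg_two [Finite ι] (h : IsLinked b A θ l a) {l' : List ι} {β β' : ι}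
    (hβ : β ∈ l) (hβ' : β' ∈ l) (hβa : P.pairing β a = -1) (haβ : P.pairing a β = -1)
    (hβa' : P.pairing β' a = -1) (haβ' : P.pairing a β' = -2)
    (h2 : (2 : ℤ) • P.coroot a = P.coroot θ - P.coroot β - P.coroot β')
    (hl' : IsCascadeList P (perp P (perp P (perp P A θ) β) β') l')
    (hsum : (l.map P.coroot).sum = P.coroot β + P.coroot β' + (l'.map P.coroot).sum) :
    ∃ l', IsCascadeList P (perp P A a) l' ∧ ∃ n, IsCoeff P n ∧
      ((θ :: l).map P.coroot).sum = (l'.map P.coroot).sum + n • P.coroot a := by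
  have hββ' : P.pairing β β' = 0 := by
    refine h.casc.2.2.pairing_eq_zero hβ hβ' ?_
    rintro rfl; omega
  have hβ'β := pairing_zero_symm hββ'
  have hβθ := h.pairing_head_eq_zero hβ
  have hβθ' := h.pairing_head_eq_zero hβ'
  have hβA' := h.mem_of_mem hβ'
  have hp2 (i : ι) : 2 * P.pairing i a = P.pairing i θ - P.pairing i β - P.pairing i β' := by
    simpa only [← root_coroot_eq_pairing, map_sub, map_smul, smul_eq_mul] using
      congrArg (P.toLinearMap (P.root i)) h2
  obtain ⟨φ, hφ⟩ : ∃ φ, P.reflectionPerm β' a = φ := ⟨_, rfl⟩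
  obtain ⟨ψ, hψ⟩ : ∃ ψ, P.reflectionPerm β (P.reflectionPerm a β') = ψ := ⟨_, rfl⟩
  have hcφ : P.coroot φ = P.coroot a + P.coroot β' := by
    rw [← hφ, coroot_reflect, hβa']; module
  have hcψ : P.coroot ψ = (2 : ℤ) • P.coroot a + P.coroot β' + (2 : ℤ) • P.coroot β := by
    rw [← hψ, coroot_reflect, coroot_reflect, pairing_reflectionPerm_right,
      hββ', hβa, haβ']; module
  have hpφ (i : ι) : P.pairing i φ = P.pairing i a + P.pairing i β' := by
    simp only [← root_coroot_eq_pairing, hcφ, map_add]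
  have hpψ (i : ι) : P.pairing i ψ = P.pairing i θ + P.pairing i β := by
    have : P.pairing i ψ = 2 * P.pairing i a + P.pairing i β' + 2 * P.pairing i β := by
      simp only [← root_coroot_eq_pairing, hcψ, map_add, map_smul, smul_eq_mul]
    linarith [hp2 i]
  have haβA : P.reflectionPerm a β' ∈ A := h.simple β' hβA' (h.ne_of_mem (by rw [hβθ']; decide))
  have haβθ : P.pairing (P.reflectionPerm a β') θ = 1 := by
    rw [pairing_reflectionPerm_left, hβθ', hβa', h.pairing]; norm_num
  have hφA := hφ ▸ h.reflectionPerm_mem hβ' h.mem h.pairing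
  have hφa : P.pairing φ a = 0 := by
    rw [← hφ, pairing_reflectionPerm_left, pairing_same, hβa', haβ']; norm_num
  have hcase (γ : ι) (hγ : γ ∈ perp P A a) : P.pairing γ θ = 0 ∨ P.pairing γ θ = 1 :=
    h.pairing_head_cases hγ.1 fun h' => by
      have := h.one_le_pairing
      have := hγ.2
      rw [h'] at this
      omega
  refine ⟨ψ :: φ :: l', ⟨⟨?_, ?_⟩, fun γ hγ hne => ?_, ⟨⟨hφA.1, hφa⟩, ?_⟩, fun γ hγ hne => ?_, ?_⟩,
    -1, isCoeff_neg_one, ?_⟩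
  · exact hψ ▸ (h.reflectionPerm_mem hβ haβA haβθ).1
  · rw [← hψ, pairing_reflectionPerm_left, pairing_reflectionPerm_left,
      pairing_reflectionPerm_left, pairing_same, hβ'β, haβ, hβa, hβa']; norm_num
  · rw [hpψ]
    have h3 := hp2 γ
    rw [hγ.2] at h3
    rcases hcase γ hγ with h4 | h4
    · rw [h4] at h3 ⊢
      rcases lt_trichotomy (P.pairing γ β) 0 with h5 | h5 | h5
      · have h6 : 0 < P.pairing γ β' := by omega
        obtain ⟨p, q, hl⟩ := List.append_of_mem hβ'
        rcases (h.lead_eq hl hγ.1 h4 (by rw [hγ.2, hβa']; omega) h6).1 with h7 | h7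
        · have := hγ.2; rw [h7] at this; omega
        · exact absurd (by omega) (h.pairing_ne_neg_one hβ hβ' hβa haβ hβa' haβ' hγ.1 h4 hγ.2 h6)
      · omega
      · obtain ⟨p, q, hl⟩ := List.append_of_mem hβ
        rcases (h.lead_eq hl hγ.1 h4 (by rw [hγ.2, hβa]; omega) h5).1 with h7 | h7
        · have := hγ.2; rw [h7] at this; omega
        · omega
    · have h5 := h.abs_pairing_le_one hβ hβa (by omega) hγ.1 h4 hγ.2
      have h6 : P.pairing γ β ≠ 1 := fun h6 => hne <| by
        obtain ⟨h7, h8⟩ := h.reflectionPerm_mem hβ hγ.1 h4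
        have h9 : P.pairing (P.reflectionPerm β γ) a = 1 := by
          rw [pairing_reflectionPerm_left, hγ.2, h6, hβa]; norm_num
        -- `ε = s_a s_β γ` pairs to `2` with `β'`, which forces `ε = β'`
        obtain ⟨ε, hε⟩ : ∃ ε, P.reflectionPerm a (P.reflectionPerm β γ) = ε := ⟨_, rfl⟩
        have hεA : ε ∈ A := by
          refine hε ▸ h.simple _ h7 fun h8 => ?_
          rw [h8, pairing_same] at h9; norm_num at h9
        have hεθ : P.pairing ε θ = 0 := by
          rw [← hε, pairing_reflectionPerm_left, h8, h9, h.pairing]; norm_num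
        have hεa : P.pairing ε a = -1 := by
          rw [← hε, pairing_reflectionPerm_left, h9, pairing_same]; norm_num
        have hεβ : P.pairing ε β' = 2 := by
          rw [← hε, pairing_reflectionPerm_left, h9, haβ', pairing_reflectionPerm_left, hββ']
          omega
        obtain ⟨p, q, hl⟩ := List.append_of_mem hβ'
        have := (h.lead_eq hl hεA hεθ (by rw [hεa, hεβ, hβa']; norm_num)
          (by rw [hεβ]; norm_num)).1.resolve_right (by rw [hεβ]; norm_num)
        rw [← hψ, ← reflectionPerm_eq_comm, ← reflectionPerm_eq_comm, hε, this]
      omega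
  · rw [hpψ, hφA.2, ← hφ, pairing_reflectionPerm_left, haβ, hβ'β]; norm_num
  · left
    have h3 := hp2 γ
    have h4 := hγ.2
    rw [hγ.1.2] at h3
    rw [hpψ] at h4
    rw [hpφ, hγ.1.2]
    rcases hcase γ hγ.1 with h5 | h5
    · omega
    · refine absurd ?_ hne
      rw [← hφ, ← reflectionPerm_eq_comm]
      exact h.reflectionPerm_eq hβ' hγ.1.1 h5 (by rw [hγ.1.2, hβa']; omega)
  · convert hl' using 1
    ext i
    simp only [mem_perp, hpφ, hpψ]
    have h3 := hp2 i
    constructor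
    · rintro ⟨⟨⟨h4, h5⟩, h6⟩, h7⟩
      have := hcase i ⟨h4, h5⟩
      refine ⟨⟨⟨h4, ?_⟩, ?_⟩, ?_⟩ <;> omega
    · rintro ⟨⟨⟨h4, h5⟩, h6⟩, h7⟩
      refine ⟨⟨⟨h4, ?_⟩, ?_⟩, ?_⟩ <;> omega
  · have h3 : P.coroot θ = (2 : ℤ) • P.coroot a + P.coroot β + P.coroot β' := by rw [h2]; module
    simp only [List.map_cons, List.sum_cons, hsum, hcφ, hcψ, h3]
    module

/-- The reflections of `a` in two cascade members of the length of `a`, with their properties in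
the simply laced case. -/
theorem exists_reflectionPerm_reflectionPerm [Finite ι] (h : IsLinked b A θ l a) {β β' : ι}
    (hβ : β ∈ l) (hβ' : β' ∈ l) (hne : β ≠ β') (hβa : P.pairing β a = -1)
    (haβ : P.pairing a β = -1) (hβa' : P.pairing β' a = -1) (haβ' : P.pairing a β' = -1) :
    ∃ φ ∈ perp P A a, P.coroot φ = P.coroot a + P.coroot β + P.coroot β' ∧
      P.pairing φ θ = 1 ∧ P.pairing φ β = 1 ∧ P.pairing φ β' = 1 ∧
      (∀ x ∈ l, x ≠ β → x ≠ β' → P.pairing φ x = P.pairing a x) ∧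
      ∀ γ ∈ perp P A a, P.pairing γ θ = 1 → P.pairing γ β = 1 → P.pairing γ β' = 1 → γ = φ := by
  have hββ' := h.casc.2.2.pairing_eq_zero hβ hβ' hne
  have hβ'β := pairing_zero_symm hββ'
  obtain ⟨h1, h2⟩ := h.reflectionPerm_mem hβ' h.mem h.pairing
  obtain ⟨h3, h4⟩ := h.reflectionPerm_mem hβ h1 h2
  have hp (x : ι) : P.pairing (P.reflectionPerm β (P.reflectionPerm β' a)) x =
      P.pairing a x + P.pairing β x + P.pairing β' x := by
    rw [pairing_reflectionPerm_left, pairing_reflectionPerm_left, pairing_reflectionPerm_left,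
      haβ, haβ', hβ'β]; ring
  refine ⟨_, ⟨h3, ?_⟩, ?_, h4, ?_, ?_, fun x hx hxβ hxβ' => ?_, fun γ hγ e1 e2 e3 => ?_⟩
  · rw [hp, pairing_same, hβa, hβa']; norm_num
  · rw [coroot_reflect, coroot_reflect, pairing_reflectionPerm_right, hβa, hβa',
      hββ']; module
  · rw [hp, haβ, pairing_same, hβ'β]; norm_num
  · rw [hp, haβ', pairing_same, hββ']; norm_num
  · rw [hp, h.casc.2.2.pairing_eq_zero hβ hx hxβ.symm, h.casc.2.2.pairing_eq_zero hβ' hx hxβ'.symm]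
    ring
  · obtain ⟨h5, h6⟩ := h.reflectionPerm_mem hβ hγ.1 e1
    rw [← reflectionPerm_eq_comm, ← reflectionPerm_eq_comm]
    refine h.reflectionPerm_eq hβ' h5 h6 ?_
    rw [pairing_reflectionPerm_left, pairing_reflectionPerm_left, hγ.2, hβa, e2, e3, hββ', hβa']
    norm_num

/-- The simply laced case, as in types `D` and `E`: the members `θ`, `β₁`, `β₂`, `β₃` are replaced
by the three roots obtained by reflecting `a` in two of the `βᵢ`. -/
theorem exists_of_neg_one [Finite ι] (h : IsLinked b A θ l a) {p₁ p₂ p₃ p₄ : List ι}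
    {β₁ β₂ β₃ : ι} (hl : l = p₁ ++ β₁ :: (p₂ ++ β₂ :: (p₃ ++ β₃ :: p₄)))
    (hβa : ∀ β ∈ [β₁, β₂, β₃], P.pairing β a = -1) (haβ : ∀ β ∈ [β₁, β₂, β₃], P.pairing a β = -1)
    (h2 : (2 : ℤ) • P.coroot a = P.coroot θ - P.coroot β₁ - P.coroot β₂ - P.coroot β₃) :
    ∃ l', IsCascadeList P (perp P A a) l' ∧ ∃ n, IsCoeff P n ∧
      ((θ :: l).map P.coroot).sum = (l'.map P.coroot).sum + n • P.coroot a := by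
  simp only [List.mem_cons, List.not_mem_nil, or_false, forall_eq_or_imp, forall_eq] at hβa haβ
  obtain ⟨b1, b2, b3⟩ := hβa
  obtain ⟨a1, a2, a3⟩ := haβ
  have m1 : β₁ ∈ l := by simp [hl]
  have m2 : β₂ ∈ l := by simp [hl]
  have m3 : β₃ ∈ l := by simp [hl]
  have hnd := h.casc.2.2.nodup
  have n12 : β₁ ≠ β₂ := by
    rintro rfl; simp [hl, List.nodup_append] at hnd
  have n13 : β₁ ≠ β₃ := by
    rintro rfl; simp [hl, List.nodup_append] at hnd
  have n23 : β₂ ≠ β₃ := by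
    rintro rfl; simp [hl, List.nodup_append] at hnd
  have hp2 (i : ι) : 2 * P.pairing i a =
      P.pairing i θ - P.pairing i β₁ - P.pairing i β₂ - P.pairing i β₃ := by
    simpa only [← root_coroot_eq_pairing, map_sub, map_smul, smul_eq_mul] using
      congrArg (P.toLinearMap (P.root i)) h2
  obtain ⟨φ, hφ, cφ, -, -, -, -, uφ⟩ :=
    h.exists_reflectionPerm_reflectionPerm m1 m2 n12 b1 a1 b2 a2
  obtain ⟨χ, hχ, cχ, tχ, χ1, χ3, χ2, uχ⟩ :=
    h.exists_reflectionPerm_reflectionPerm m1 m3 n13 b1 a1 b3 a3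
  obtain ⟨ψ, hψ, cψ, tψ, ψ2, ψ3, ψ1, uψ⟩ :=
    h.exists_reflectionPerm_reflectionPerm m2 m3 n23 b2 a2 b3 a3
  have pφ (i : ι) : P.pairing i φ = P.pairing i a + P.pairing i β₁ + P.pairing i β₂ := by
    simp only [← root_coroot_eq_pairing, cφ, map_add]
  have pχ (i : ι) : P.pairing i χ = P.pairing i a + P.pairing i β₁ + P.pairing i β₃ := by
    simp only [← root_coroot_eq_pairing, cχ, map_add]
  have pψ (i : ι) : P.pairing i ψ = P.pairing i a + P.pairing i β₂ + P.pairing i β₃ := by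
    simp only [← root_coroot_eq_pairing, cψ, map_add]
  replace χ2 := χ2 β₂ m2 n12.symm n23
  replace ψ1 := ψ1 β₁ m1 n12 n13
  have hcase (γ : ι) (hγ : γ ∈ perp P A a) : P.pairing γ θ = 0 ∨ P.pairing γ θ = 1 :=
    h.pairing_head_cases hγ.1 fun h' => by
      have := h.one_le_pairing
      have := hγ.2
      rw [h'] at this
      omega
  have hne {γ : ι} (hγ : γ ∈ perp P A a) {β : ι} (hβ : P.pairing β a = -1) : γ ≠ β := by
    rintro rfl
    have := hγ.2
    omega
  have k1 (γ : ι) (hγ : γ ∈ perp P A a) (h0 : P.pairing γ θ = 0) (h1 : 0 < P.pairing γ β₁) :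
      P.pairing γ β₁ = 1 :=
    (h.lead_eq hl hγ.1 h0 (by rw [hγ.2, b1]; omega) h1).1.resolve_left (hne hγ b1)
  have k2 (γ : ι) (hγ : γ ∈ perp P A a) (h0 : P.pairing γ θ = 0) (h1 : 0 < P.pairing γ β₂) :
      P.pairing γ β₂ = 1 ∧ P.pairing γ β₁ = 0 := by
    have := h.lead_eq (p := p₁ ++ β₁ :: p₂) (q := p₃ ++ β₃ :: p₄) (by simp [hl]) hγ.1 h0
      (by rw [hγ.2, b2]; omega) h1
    exact ⟨this.1.resolve_left (hne hγ b2), this.2 _ (by simp)⟩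
  have k3 (γ : ι) (hγ : γ ∈ perp P A a) (h0 : P.pairing γ θ = 0) (h1 : 0 < P.pairing γ β₃) :
      P.pairing γ β₃ = 1 ∧ P.pairing γ β₁ = 0 ∧ P.pairing γ β₂ = 0 := by
    have := h.lead_eq (p := p₁ ++ β₁ :: (p₂ ++ β₂ :: p₃)) (q := p₄) (by simp [hl]) hγ.1 h0
      (by rw [hγ.2, b3]; omega) h1
    exact ⟨this.1.resolve_left (hne hγ b3), this.2 _ (by simp), this.2 _ (by simp)⟩
  have ab1 (γ : ι) (hγ : γ ∈ perp P A a) (h0 : P.pairing γ θ = 1) :=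
    h.abs_pairing_le_one m1 b1 (by omega) hγ.1 h0 hγ.2
  have ab2 (γ : ι) (hγ : γ ∈ perp P A a) (h0 : P.pairing γ θ = 1) :=
    h.abs_pairing_le_one m2 b2 (by omega) hγ.1 h0 hγ.2
  have ab3 (γ : ι) (hγ : γ ∈ perp P A a) (h0 : P.pairing γ θ = 1) :=
    h.abs_pairing_le_one m3 b3 (by omega) hγ.1 h0 hγ.2
  refine ⟨φ :: χ :: ψ :: (p₁ ++ (p₂ ++ (p₃ ++ p₄))), ⟨hφ, fun γ hγ hne => ?_, ⟨hχ, ?_⟩,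
    fun γ hγ hne => ?_, ⟨⟨hψ, ?_⟩, ?_⟩, fun γ hγ hne => ?_, ?_⟩, -1, isCoeff_neg_one, ?_⟩
  · rw [pφ, hγ.2]
    have h3 := hp2 γ
    rw [hγ.2] at h3
    rcases hcase γ hγ with h4 | h4
    · have := k1 γ hγ h4
      have := k2 γ hγ h4
      have := k3 γ hγ h4
      omega
    · have := ab1 γ hγ h4
      have := ab2 γ hγ h4
      have := ab3 γ hγ h4
      by_cases h5 : P.pairing γ β₁ = 1
      · have := mt (uφ γ hγ h4 h5) hne
        omega
      · omega
  · rw [pφ, hχ.2, χ1, χ2, a2]; norm_num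
  · have h3 := hp2 γ
    have h5 := hγ.2
    rw [pφ] at h5
    rw [hγ.1.2] at h3 h5
    rw [pχ, hγ.1.2]
    rcases hcase γ hγ.1 with h4 | h4
    · have := k1 γ hγ.1 h4
      have := k2 γ hγ.1 h4
      have := k3 γ hγ.1 h4
      omega
    · have := ab1 γ hγ.1 h4
      have := ab2 γ hγ.1 h4
      have := ab3 γ hγ.1 h4
      by_cases h5 : P.pairing γ β₁ = 1
      · have := mt (uχ γ hγ.1 h4 h5) hne
        omega
      · omega
  · rw [pφ, hψ.2, ψ1, ψ2, a1]; norm_num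
  · rw [pχ, hψ.2, ψ1, ψ3, a1]; norm_num
  · have h3 := hp2 γ
    have h5 := hγ.1.2
    have h6 := hγ.2
    rw [pφ] at h5
    rw [pχ] at h6
    rw [hγ.1.1.2] at h3 h5 h6
    rw [pψ, hγ.1.1.2]
    rcases hcase γ hγ.1.1 with h4 | h4
    · omega
    · have := ab1 γ hγ.1.1 h4
      have := ab2 γ hγ.1.1 h4
      have := ab3 γ hγ.1.1 h4
      by_cases h5 : P.pairing γ β₂ = 1
      · have := mt (uψ γ hγ.1.1 h4 h5) hne
        omega
      · omega
  · have hc := h.casc.2.2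
    rw [hl] at hc
    have hc1 := hc.erase
    rw [← List.append_assoc] at hc1
    have hc2 := hc1.erase
    rw [← List.append_assoc] at hc2
    have hc3 := hc2.erase
    simp only [List.append_assoc] at hc3
    convert hc3 using 1
    ext i
    simp only [mem_perp, pφ, pχ, pψ]
    have h3 := hp2 i
    constructor <;> rintro ⟨⟨⟨⟨h4, h5⟩, h6⟩, h7⟩, h8⟩ <;>
      refine ⟨⟨⟨⟨h4, ?_⟩, ?_⟩, ?_⟩, ?_⟩ <;> omega
  · have h3 : P.coroot θ =
        (2 : ℤ) • P.coroot a + P.coroot β₁ + P.coroot β₂ + P.coroot β₃ := by rw [h2]; module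
    simp only [hl, List.map_cons, List.map_append, List.sum_cons, List.sum_append, cφ, cχ, cψ, h3]
    module

/-- All cases for a simple root `a ≠ θ` that is not orthogonal to `θ`. If `⟨θ, a⟩ = 1`, then
`sum_pairing` says that the products `⟨β, a⟩⟨a, β⟩` over the cascade members `β ≠ θ` add up to `3`,
so that the nonzero ones are `3`, or `1` and `2`, or `1`, `1` and `1`. -/
theorem exists_isCascadeList_perp [Finite ι] (h : IsLinked b A θ l a) :
    ∃ l', IsCascadeList P (perp P A a) l' ∧ ∃ n, IsCoeff P n ∧
      ((θ :: l).map P.coroot).sum = (l'.map P.coroot).sum + n • P.coroot a := by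
  have hle := h.pairing_le_two
  have hge := h.one_le_pairing
  obtain h2 | h1 : P.pairing θ a = 2 ∨ P.pairing θ a = 1 := by omega
  · exact h.exists_of_eq_two h2
  have hsum := h.sum_pairing
  have htwo := h.two_smul
  rw [h1] at hsum htwo
  have hnp (β : ι) (hβ : β ∈ l) := h.pairing_nonpos hβ
  have hnp1 (β : ι) (hβ : β ∈ l) := h.neg_one_le_pairing h1 hβ
  have zero {q : List ι} (hq : ∀ β ∈ q, P.pairing β a = 0) :
      (q.map fun β => P.pairing β a * P.pairing a β).sum = 0 ∧
      (q.map fun β => P.pairing β a • P.coroot β).sum = 0 :=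
    ⟨sum_map_eq_zero fun β hβ => by rw [hq β hβ, zero_mul],
      sum_map_eq_zero fun β hβ => by rw [hq β hβ, zero_smul]⟩
  obtain h0 | ⟨p₁, β₁, q₁, rfl, hp₁, hβ₁, hβ₁'⟩ := exists_split l hnp
  · rw [(zero h0).1] at hsum; omega
  have hb₁ : P.pairing β₁ a = -1 := by
    have := hnp1 β₁ (by simp); omega
  have hnq₁ (β : ι) (hβ : β ∈ q₁) := hnp β (by simp [hβ])
  have hs₁ := sum_pairing_nonneg q₁ hnq₁
  simp only [List.map_append, List.map_cons, List.sum_append, List.sum_cons, (zero hp₁).1,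
    (zero hp₁).2, hb₁] at hsum htwo
  obtain h0 | ⟨p₂, β₂, q₂, rfl, hp₂, hβ₂, hβ₂'⟩ := exists_split q₁ hnq₁
  · rw [(zero h0).1] at hsum
    rw [(zero h0).2] at htwo
    exact h.exists_of_neg_three rfl hb₁ (by omega) (by rw [htwo]; module)
  have hb₂ : P.pairing β₂ a = -1 := by
    have := hnp1 β₂ (by simp); omega
  have hnq₂ (β : ι) (hβ : β ∈ q₂) := hnq₁ β (by simp [hβ])
  have hs₂ := sum_pairing_nonneg q₂ hnq₂
  simp only [List.map_append, List.map_cons, List.sum_append, List.sum_cons, (zero hp₂).1,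
    (zero hp₂).2, hb₂] at hsum htwo
  have hc1 := h.casc.2.2.erase
  rw [← List.append_assoc] at hc1
  have hc2 := hc1.erase
  obtain h0 | ⟨p₃, β₃, q₃, rfl, hp₃, hβ₃, hβ₃'⟩ := exists_split q₂ hnq₂
  · rw [(zero h0).1] at hsum
    rw [(zero h0).2] at htwo
    obtain ⟨e1, e2⟩ | ⟨e1, e2⟩ : (P.pairing a β₁ = -1 ∧ P.pairing a β₂ = -2) ∨
        (P.pairing a β₁ = -2 ∧ P.pairing a β₂ = -1) := by omega
    · refine h.exists_of_neg_one_neg_two (β := β₁) (β' := β₂) (by simp) (by simp) hb₁ e1 hb₂ e2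
        (by rw [htwo]; module) hc2 ?_
      simp only [List.map_append, List.map_cons, List.sum_append, List.sum_cons]
      abel
    · rw [perp_comm] at hc2
      refine h.exists_of_neg_one_neg_two (β := β₂) (β' := β₁) (by simp) (by simp) hb₂ e2 hb₁ e1
        (by rw [htwo]; module) hc2 ?_
      simp only [List.map_append, List.map_cons, List.sum_append, List.sum_cons]
      abel
  have hb₃ : P.pairing β₃ a = -1 := by
    have := hnp1 β₃ (by simp); omega
  have hnq₃ (β : ι) (hβ : β ∈ q₃) := hnq₂ β (by simp [hβ])
  have hs₃ := sum_pairing_nonneg q₃ hnq₃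
  simp only [List.map_append, List.map_cons, List.sum_append, List.sum_cons, (zero hp₃).1,
    (zero hp₃).2, hb₃] at hsum htwo
  obtain h0 | ⟨p₄, β₄, q₄, rfl, hp₄, hβ₄, hβ₄'⟩ := exists_split q₃ hnq₃
  · rw [(zero h0).1] at hsum
    rw [(zero h0).2] at htwo
    refine h.exists_of_neg_one rfl ?_ ?_ (by rw [htwo]; module)
    · simp [hb₁, hb₂, hb₃]
    · simp only [List.mem_cons, List.not_mem_nil, or_false, forall_eq_or_imp, forall_eq]
      omega
  · have hb₄ : P.pairing β₄ a = -1 := by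
      have := hnp1 β₄ (by simp); omega
    have hs₄ := sum_pairing_nonneg q₄ fun β hβ => hnq₃ β (by simp [hβ])
    simp only [List.map_append, List.map_cons, List.sum_append, List.sum_cons, (zero hp₄).1,
      hb₄] at hsum
    omega

end IsLinked

/-- Passing from a positive subsystem `A` whose cascade `l` spans the simple root `a` to the members
of `A` orthogonal to `a` changes the sum of the coroots of the cascade by `-a^∨`, `0` or `a^∨`. -/
theorem IsCascadeList.exists_perp [Finite ι] {b : P.Base} {A : Set ι} {l : List ι} {a : ι}
    (hl : IsCascadeList P A l) (hA : IsPosSubsystem b A) (ha : a ∈ A)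
    (hs : ∀ i ∈ A, i ≠ a → P.reflectionPerm a i ∈ A)
    (h2 : (2 : ℤ) • P.coroot a = (l.map fun β => P.pairing β a • P.coroot β).sum) :
    ∃ l', IsCascadeList P (perp P A a) l' ∧ ∃ n, IsCoeff P n ∧
      (l.map P.coroot).sum = (l'.map P.coroot).sum + n • P.coroot a := by
  induction l generalizing A with
  | nil => rw [show A = ∅ from hl] at ha; exact ha.elim
  | cons θ l ih =>
    by_cases haθ : a = θ
    · exact ⟨l, haθ ▸ hl.2.2, 1, isCoeff_one, by simp [haθ, add_comm]⟩
    simp only [List.map_cons, List.sum_cons] at h2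
    rcases hl.2.1 a ha haθ with h0 | h1
    · have h0' := pairing_zero_symm h0
      rw [h0', zero_smul, zero_add] at h2
      obtain ⟨l', hl', n, hn, hsum⟩ := ih hl.2.2 (hA.perp θ) ⟨ha, h0⟩
        (fun i hi hia => ⟨hs i hi.1 hia, by rw [pairing_reflectionPerm_left, hi.2, h0]; ring⟩) h2
      refine ⟨θ :: l', ⟨⟨hl.1, h0'⟩, fun i hi => hl.2.1 i hi.1, ?_⟩, n, hn, ?_⟩
      · rwa [perp_comm]
      · simp only [List.map_cons, List.sum_cons, hsum, add_assoc]
    · exact IsLinked.exists_isCascadeList_perp ⟨hA, hl, ha, hs, h1, h2⟩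

/-! ### Cascade lists enumerate Kostant's cascade -/

/-- The pairing with the coroot of `i`, extended to the real vector space `ℝ ⊗ X`. -/
noncomputable def realCoroot (P : RootPairing ι ℤ X Y) (i : ι) : ℝ ⊗[ℤ] X →ₗ[ℝ] ℝ :=
  Module.Dual.baseChange ℝ (P.coroot' i)

theorem realCoroot_tmul (i : ι) (x : X) :
    realCoroot P i (TensorProduct.tmul ℤ (1 : ℝ) x) = (P.coroot' i x : ℝ) := by
  simp [realCoroot]

/-- A vector of `ℝ ⊗ X` is lexicographically nonnegative with respect to a list of roots if it is
orthogonal to all of them or if it pairs positively with the first one that it is not orthogonal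
to. -/
def LexNonneg (P : RootPairing ι ℤ X Y) : List ι → ℝ ⊗[ℤ] X → Prop
  | [], _ => True
  | i :: l, v => 0 < realCoroot P i v ∨ (realCoroot P i v = 0 ∧ LexNonneg P l v)

theorem lexNonneg_of_forall_eq_zero {l : List ι} {v : ℝ ⊗[ℤ] X}
    (h : ∀ i ∈ l, realCoroot P i v = 0) : LexNonneg P l v := by
  induction l with
  | nil => trivial
  | cons i l ih => exact Or.inr ⟨h i (by simp), ih fun j hj => h j (by simp [hj])⟩

theorem LexNonneg.add {l : List ι} {v w : ℝ ⊗[ℤ] X} (hv : LexNonneg P l v)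
    (hw : LexNonneg P l w) : LexNonneg P l (v + w) := by
  induction l with
  | nil => trivial
  | cons i l ih =>
    simp only [LexNonneg, map_add] at *
    rcases hv with hv | hv <;> rcases hw with hw | hw
    · left; linarith
    · left; linarith
    · left; linarith
    · exact Or.inr ⟨by linarith, ih hv.2 hw.2⟩

theorem LexNonneg.smul {l : List ι} {v : ℝ ⊗[ℤ] X} (hv : LexNonneg P l v) {c : ℝ} (hc : 0 ≤ c) :
    LexNonneg P l (c • v) := by
  rcases hc.eq_or_lt with rfl | hc
  · exact lexNonneg_of_forall_eq_zero fun i _ => by simp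
  induction l with
  | nil => trivial
  | cons i l ih =>
    simp only [LexNonneg, map_smul, smul_eq_mul] at *
    rcases hv with hv | hv
    · exact Or.inl (mul_pos hc hv)
    · exact Or.inr ⟨by rw [hv.1, mul_zero], ih hv.2⟩

theorem LexNonneg.nonneg {p q : List ι} {i : ι} {v : ℝ ⊗[ℤ] X}
    (hv : LexNonneg P (p ++ i :: q) v) (hp : ∀ j ∈ p, realCoroot P j v = 0) :
    0 ≤ realCoroot P i v := by
  induction p with
  | nil =>
    rcases hv with hv | hv
    · exact hv.le
    · exact hv.1.ge
  | cons j p ih =>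
    rcases hv with hv | hv
    · exact absurd (hp j (by simp)) hv.ne'
    · exact ih hv.2 fun k hk => hp k (by simp [hk])

namespace IsCascadeList

variable {b : P.Base} {A : Set ι} {l : List ι}

/-- The roots of `A`, and hence the cone that they span, are lexicographically nonnegative with
respect to a cascade of `A`. -/
theorem lexNonneg_root (hl : IsCascadeList P A l) {i : ι} (hi : i ∈ A) :
    LexNonneg P l (TensorProduct.tmul ℤ (1 : ℝ) (P.root i)) := by
  induction l generalizing A with
  | nil => trivial
  | cons θ l ih =>
    have h := hl.pairing_head_nonneg hi
    rcases h.eq_or_lt with h | h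
    · refine Or.inr ⟨?_, ih hl.2.2 ⟨hi, h.symm⟩⟩
      rw [realCoroot_tmul, root_coroot'_eq_pairing, ← h, Int.cast_zero]
    · left
      rw [realCoroot_tmul, root_coroot'_eq_pairing]
      exact_mod_cast h

theorem lexNonneg_of_mem_hull (hl : IsCascadeList P A l) {v : ℝ ⊗[ℤ] X}
    (hv : v ∈ PointedCone.hull ℝ ((fun k => TensorProduct.tmul ℤ (1 : ℝ) (P.root k)) '' A)) :
    LexNonneg P l v := by
  refine Submodule.span_induction ?_ ?_ ?_ ?_ hv
  · rintro _ ⟨i, hi, rfl⟩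
    exact hl.lexNonneg_root hi
  · exact lexNonneg_of_forall_eq_zero fun i _ => map_zero _
  · exact fun _ _ _ _ => LexNonneg.add
  · exact fun c _ _ h => h.smul c.2

/-- A cascade member is maximal among the roots of `A` orthogonal to all earlier ones. -/
theorem eq_of_rootLE {p q : List ι} {β : ι} (hl : IsCascadeList P A (p ++ β :: q)) {i : ι}
    (hi : i ∈ A) (hp : ∀ j ∈ p, P.pairing i j = 0) (hle : RootLE P A β i) : i = β := by
  have h := (hl.lexNonneg_of_mem_hull hle).nonneg fun j hj => by
    have : P.pairing β j = 0 := by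
      refine hl.pairing_eq_zero (by simp) (by simp [hj]) ?_
      rintro rfl
      have := hl.nodup
      simp only [List.nodup_append, List.mem_cons] at this
      exact this.2.2 β hj β (Or.inl rfl) rfl
    rw [realCoroot_tmul, map_sub, root_coroot'_eq_pairing, root_coroot'_eq_pairing, hp j hj, this]
    simp
  rw [realCoroot_tmul, map_sub, root_coroot'_eq_pairing, root_coroot'_eq_pairing,
    pairing_same] at h
  have h' : 0 ≤ P.pairing i β - 2 := by exact_mod_cast h
  rcases hl.pairing_eq_zero_or_one hi hp with h1 | h1 | h1
  · exact h1
  · omega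
  · omega

/-- A root of `A` lies below its leading cascade member. -/
theorem rootLE_lead (hA : IsPosSubsystem b A) {p q : List ι} {β : ι}
    (hl : IsCascadeList P A (p ++ β :: q)) {i : ι} (hi : i ∈ A)
    (hp : ∀ j ∈ p, P.pairing i j = 0) (h1 : P.pairing i β = 1) : RootLE P A i β := by
  have hβ : β ∈ A := hl.mem β (by simp)
  have hr : P.root β - P.root i =
      P.root (P.reflectionPerm (P.reflectionPerm β i) (P.reflectionPerm β i)) := by
    rw [root_reflectionPerm, reflection_apply_self, root_reflectionPerm, reflection_apply_root, h1]
    simp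
  refine PointedCone.subset_hull ⟨_, (hA.closed i hi β hβ).resolve_left fun h => ?_, ?_⟩
  · have h3 : P.pairing (P.reflectionPerm β i) β = -1 := by
      rw [pairing_reflectionPerm_left, h1, pairing_same]; norm_num
    have h4 : ∀ j ∈ p, P.pairing (P.reflectionPerm β i) j = 0 := by
      intro j hj
      have : P.pairing β j = 0 := by
        refine hl.pairing_eq_zero (by simp) (by simp [hj]) ?_
        rintro rfl
        have := hp β hj
        omega
      rw [pairing_reflectionPerm_left, hp j hj, this]; ring
    rcases hl.pairing_eq_zero_or_one h h4 with h5 | h5 | h5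
    · rw [h5, pairing_same] at h3; omega
    · omega
    · omega
  · rw [hr]

theorem cascadeUpTo_subset (hl : IsCascadeList P A l) (hA : IsPosSubsystem b A) (n : ℕ) :
    cascadeUpTo P A n ⊆ {i | i ∈ l} := by
  induction n with
  | zero => exact Set.empty_subset _
  | succ n ih =>
    refine Set.union_subset ih ?_
    rintro i ⟨⟨hi, horth⟩, hmax⟩
    obtain ⟨p, β, q, rfl, hp, rfl | h1⟩ := hl.exists_lead hi
    · simp
    · have hβ : β ∈ p ++ β :: q := by simp
      have := hmax β ⟨hl.mem β hβ, fun j hj => ?_⟩ (rootLE_lead hA hl hi hp h1)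
      · rw [← this]; exact hβ
      · refine hl.pairing_eq_zero hβ (ih hj) ?_
        rintro rfl
        have := horth β hj
        omega

theorem subset_cascadeUpTo (hl : IsCascadeList P A l) (hA : IsPosSubsystem b A) {p q : List ι}
    (hpq : l = p ++ q) : ∀ i ∈ p, i ∈ cascadeUpTo P A p.length := by
  induction p using List.reverseRecOn generalizing q with
  | nil => simp
  | append_singleton p β ih =>
    subst hpq
    have ih' := ih (q := β :: q) (by simp)
    intro i hi
    rw [List.length_append, List.length_singleton]
    simp only [List.mem_append, List.mem_singleton] at hi
    by_cases hi' : i ∈ cascadeUpTo P A p.length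
    · exact Or.inl hi'
    rcases hi with hi | rfl
    · exact absurd (ih' i hi) hi'
    · have hl' : IsCascadeList P A (p ++ i :: q) := by simpa using hl
      refine Or.inr ⟨⟨hl.mem i (by simp), fun j hj => ?_⟩, fun j hj hle => ?_⟩
      · refine hl.pairing_eq_zero (by simp) (hl.cascadeUpTo_subset hA _ hj) ?_
        rintro rfl
        exact hi' hj
      · exact hl'.eq_of_rootLE hj.1 (fun k hk => hj.2 k (ih' k hk)) hle

theorem cascade_eq (hl : IsCascadeList P A l) (hA : IsPosSubsystem b A) :
    cascade P A = {i | i ∈ l} := by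
  refine Set.Subset.antisymm (Set.iUnion_subset fun n => hl.cascadeUpTo_subset hA n) fun i hi => ?_
  exact Set.mem_iUnion.2 ⟨_, hl.subset_cascadeUpTo hA (q := []) (by simp) i hi⟩

theorem finsum_cascade (hl : IsCascadeList P A l) (hA : IsPosSubsystem b A) :
    ∑ᶠ k ∈ cascade P A, P.coroot k = (l.map P.coroot).sum := by
  classical
  rw [hl.cascade_eq hA, ← List.sum_toFinset _ hl.nodup, ← finsum_mem_coe_finset]
  simp

end IsCascadeList

/-! ### The action of the Weyl group on roots and coroots -/

theorem smul_root (w : P.weylGroup) (i : ι) : w • P.root i = P.root (w • i) :=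
  P.weylGroup_apply_root w i

theorem coAct_one (y : Y) : coAct P 1 y = y := by
  simp [coAct]

theorem coAct_mul (v w : P.weylGroup) (y : Y) : coAct P (v * w) y = coAct P v (coAct P w y) := by
  simp only [coAct, Subgroup.coe_mul, mul_inv_rev, map_mul, MulOpposite.unop_mul]
  rfl

theorem coAct_ofIdx (i : ι) (y : Y) :
    coAct P (weylGroup.ofIdx P i) y = P.coreflection i y := by
  simp only [coAct, weylGroup.ofIdx, Equiv.reflection_inv]
  rfl

theorem ofIdx_smul_index (i j : ι) : weylGroup.ofIdx P i • j = P.reflectionPerm i j := rfl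

/-- The two actions of the Weyl group are contragredient. -/
theorem toLinearMap_coAct (w : P.weylGroup) (x : X) (y : Y) :
    P.toLinearMap (w • x) (coAct P w y) = P.toLinearMap x y := by
  obtain ⟨w, hw⟩ := w
  induction hw using weylGroup.induction generalizing x y with
  | mem i =>
    change P.toLinearMap (P.reflection i x) (coAct P (weylGroup.ofIdx P i) y) = _
    rw [coAct_ofIdx, reflection_apply, coreflection_apply,
      show P.root' i y = P.toLinearMap (P.root i) y from rfl]
    simp only [map_sub, map_smul, LinearMap.sub_apply, LinearMap.smul_apply, smul_eq_mul,
      root_coroot_two, LinearMap.flip_apply]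
    ring
  | one => exact congrArg _ (coAct_one y)
  | mul v w hv hw ihv ihw =>
    rw [← Submonoid.mk_mul_mk _ v w hv hw, coAct_mul, mul_smul, ihv, ihw]

theorem coAct_coroot (w : P.weylGroup) (i : ι) : coAct P w (P.coroot i) = P.coroot (w • i) := by
  obtain ⟨w, hw⟩ := w
  induction hw using weylGroup.induction generalizing i with
  | mem j => exact (coAct_ofIdx j _).trans (P.coroot_reflectionPerm j i).symm
  | one => exact coAct_one _
  | mul v w hv hw ihv ihw =>
    rw [← Submonoid.mk_mul_mk _ v w hv hw, coAct_mul, mul_smul, ihw, ihv]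

theorem pairing_smul_smul (w : P.weylGroup) (i j : ι) :
    P.pairing (w • i) (w • j) = P.pairing i j := by
  rw [← root_coroot_eq_pairing, ← smul_root, ← coAct_coroot, toLinearMap_coAct,
    root_coroot_eq_pairing]

theorem weylGroup_ext {v w : P.weylGroup} (h : ∀ x : X, v • x = w • x) : v = w :=
  Subtype.ext (Equiv.weightHom_injective P (LinearEquiv.ext h))

theorem mul_ofIdx (w : P.weylGroup) (i : ι) :
    w * weylGroup.ofIdx P i = weylGroup.ofIdx P (w • i) * w := by
  refine weylGroup_ext fun x => ?_
  rw [mul_smul, mul_smul]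
  change w • P.reflection i x = P.reflection (w • i) (w • x)
  have h : P.coroot' (w • i) (w • x) = P.coroot' i x := by
    have := toLinearMap_coAct w x (P.coroot i)
    rwa [coAct_coroot] at this
  rw [reflection_apply, reflection_apply, ← smul_root, h, smul_sub, smul_comm]

theorem smul_reflectionPerm (w : P.weylGroup) (i j : ι) :
    w • P.reflectionPerm i j = P.reflectionPerm (w • i) (w • j) := by
  rw [← ofIdx_smul_index, ← mul_smul, mul_ofIdx, mul_smul, ofIdx_smul_index]

theorem ofIdx_mul_self (i : ι) : weylGroup.ofIdx P i * weylGroup.ofIdx P i = 1 :=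
  Subtype.ext <| mul_eq_one_iff_inv_eq.2 (RootPairing.Equiv.reflection_inv P i)

theorem ofIdx_reflectionPerm (i j : ι) : weylGroup.ofIdx P (P.reflectionPerm i j) =
    weylGroup.ofIdx P i * weylGroup.ofIdx P j * weylGroup.ofIdx P i := by
  rw [mul_ofIdx (weylGroup.ofIdx P i) j, mul_assoc, ofIdx_mul_self, mul_one, ofIdx_smul_index]

theorem neg_neg_index (i : ι) :
    P.reflectionPerm (P.reflectionPerm i i) (P.reflectionPerm i i) = i :=
  P.root.injective <| by
    rw [root_reflectionPerm, reflection_apply_self, root_reflectionPerm, reflection_apply_self,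
      neg_neg]

theorem ofIdx_neg (i : ι) : weylGroup.ofIdx P (P.reflectionPerm i i) = weylGroup.ofIdx P i := by
  rw [ofIdx_reflectionPerm, ofIdx_mul_self, one_mul]

theorem eq_or_eq_neg_of_reflectionPerm_eq [P.IsReduced] {i j : ι}
    (h : P.reflectionPerm i i = P.reflectionPerm j i) : i = j ∨ i = P.reflectionPerm j j := by
  have h2 : (2 : ℤ) • P.root i = P.pairing i j • P.root j := by
    have h2 := congrArg P.root h
    rw [root_reflectionPerm, root_reflectionPerm, reflection_apply_root, reflection_apply_root,
      pairing_same, sub_right_inj] at h2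
    exact h2
  have h3 : ¬ LinearIndependent ℤ ![P.root i, P.root j] := by
    rw [LinearIndependent.pair_iff]
    intro h3
    have := (h3 2 (-P.pairing i j) (by rw [h2, neg_smul, add_neg_cancel])).1
    norm_num at this
  refine (IsReduced.eq_or_eq_neg i j h3).imp (fun h => P.root.injective h) fun h => ?_
  exact P.root.injective (by rw [h, root_reflectionPerm, reflection_apply_self])

theorem eq_or_eq_neg_of_ofIdx_eq [P.IsReduced] {i j : ι}
    (h : weylGroup.ofIdx P i = weylGroup.ofIdx P j) : i = j ∨ i = P.reflectionPerm j j :=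
  eq_or_eq_neg_of_reflectionPerm_eq (by rw [← ofIdx_smul_index, h, ofIdx_smul_index])

theorem simpleRefl_eq (b : P.Base) (i : b.support) : simpleRefl b i = weylGroup.ofIdx P i := rfl

theorem simpleRefl_mul_comm_iff [P.IsReduced] (b : P.Base) (i : b.support) (w : P.weylGroup) :
    simpleRefl b i * w = w * simpleRefl b i ↔
      w • (i : ι) = i ∨ w • (i : ι) = P.reflectionPerm i i := by
  rw [simpleRefl_eq, mul_ofIdx, mul_left_inj]
  constructor
  · exact fun h => eq_or_eq_neg_of_ofIdx_eq h.symm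
  · rintro (h | h)
    · rw [h]
    · rw [h, ofIdx_neg]

/-! ### Words in the simple reflections -/

theorem isPos_neg_iff (b : P.Base) (i : ι) : b.IsPos (P.reflectionPerm i i) ↔ ¬ b.IsPos i :=
  RootPairing.Base.IsPos.neg_iff_not b i

theorem isPos_reflectionPerm [Finite ι] [P.IsReduced] (b : P.Base) (j : b.support) {i : ι}
    (hi : b.IsPos i) (hij : i ≠ j) : b.IsPos (P.reflectionPerm j i) :=
  hi.reflectionPerm j.2 hij

theorem exists_word [Finite ι] [P.IsReduced] (b : P.Base) (w : P.weylGroup) :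
    ∃ l : List b.support, (l.map (simpleRefl b)).prod = w := by
  obtain ⟨w, hw⟩ := w
  induction hw using weylGroup.induction with
  | mem i =>
    change ∃ l : List b.support, (l.map (simpleRefl b)).prod = weylGroup.ofIdx P i
    refine b.induction_reflect i (p := fun i => ∃ l : List b.support,
      (l.map (simpleRefl b)).prod = weylGroup.ofIdx P i) ?_ ?_ ?_
    · rintro i ⟨l, hl⟩
      exact ⟨l, by rw [hl, ofIdx_neg]⟩
    · exact fun i hi => ⟨[⟨i, hi⟩], by simp [simpleRefl_eq]⟩
    · rintro i j ⟨l, hl⟩ hj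
      refine ⟨⟨j, hj⟩ :: l ++ [⟨j, hj⟩], ?_⟩
      rw [List.cons_append, List.map_cons, List.prod_cons, List.map_append, List.prod_append, hl,
        ofIdx_reflectionPerm, mul_assoc]
      simp [simpleRefl_eq]
  | one => exact ⟨[], rfl⟩
  | mul v w hv hw ihv ihw =>
    obtain ⟨l, hl⟩ := ihv
    obtain ⟨m, hm⟩ := ihw
    exact ⟨l ++ m, by rw [List.map_append, List.prod_append, hl, hm]; rfl⟩

/-- The exchange property: a simple root made negative by a word allows to delete one letter. -/
theorem exchange [Finite ι] [P.IsReduced] (b : P.Base) (l : List b.support) (i : b.support)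
    (h : ¬ b.IsPos ((l.map (simpleRefl b)).prod • (i : ι))) :
    ∃ l' : List b.support, l'.length + 1 = l.length ∧
      (l'.map (simpleRefl b)).prod = (l.map (simpleRefl b)).prod * simpleRefl b i := by
  induction l with
  | nil => exact absurd (RootPairing.Base.isPos_of_mem_support i.2) (by simpa using h)
  | cons j l ih =>
    by_cases hl : b.IsPos ((l.map (simpleRefl b)).prod • (i : ι))
    · have hij : (l.map (simpleRefl b)).prod • (i : ι) = j := by
        by_contra hne
        refine h ?_
        rw [List.map_cons, List.prod_cons, mul_smul, simpleRefl_eq, ofIdx_smul_index]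
        exact isPos_reflectionPerm b j hl hne
      refine ⟨l, by simp, ?_⟩
      rw [List.map_cons, List.prod_cons, mul_assoc, simpleRefl_eq b i, mul_ofIdx, hij, ← mul_assoc,
        simpleRefl_eq, ofIdx_mul_self, one_mul]
    · obtain ⟨l', h1, h2⟩ := ih hl
      exact ⟨j :: l', by simp [h1], by simp [h2, mul_assoc]⟩

theorem length_prod_le (b : P.Base) (l : List b.support) :
    length b (l.map (simpleRefl b)).prod ≤ l.length :=
  Nat.sInf_le ⟨l, rfl, rfl⟩

theorem exists_reduced_word [Finite ι] [P.IsReduced] (b : P.Base) (w : P.weylGroup) :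
    ∃ l : List b.support, l.length = length b w ∧ (l.map (simpleRefl b)).prod = w := by
  obtain ⟨l, hl⟩ := exists_word b w
  exact Nat.sInf_mem (s := {n | ∃ l : List b.support, l.length = n ∧
    (l.map (simpleRefl b)).prod = w}) ⟨_, l, rfl, hl⟩

theorem length_mul_lt [Finite ι] [P.IsReduced] (b : P.Base) {w : P.weylGroup} {i : b.support}
    (h : ¬ b.IsPos (w • (i : ι))) : length b (w * simpleRefl b i) < length b w := by
  obtain ⟨l, hl, rfl⟩ := exists_reduced_word b w
  obtain ⟨l', h1, h2⟩ := exchange b l i h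
  have := length_prod_le b l'
  rw [h2] at this
  omega

theorem length_inv_le [Finite ι] [P.IsReduced] (b : P.Base) (w : P.weylGroup) :
    length b w⁻¹ ≤ length b w := by
  obtain ⟨l, hl, rfl⟩ := exists_reduced_word b w
  have h : ((l.map (simpleRefl b)).prod)⁻¹ = (l.reverse.map (simpleRefl b)).prod := by
    have : (Inv.inv ∘ simpleRefl b) = simpleRefl b :=
      funext fun i => inv_eq_of_mul_eq_one_left (simpleRefl_mul_self b i)
    rw [List.prod_inv_reverse, List.map_map, this, List.map_reverse]
  rw [h, ← hl, ← List.length_reverse]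
  exact length_prod_le b _

theorem exists_descent [Finite ι] [P.IsReduced] (b : P.Base) {w : P.weylGroup} (hw : w ≠ 1) :
    ∃ i : b.support, ¬ b.IsPos (w • (i : ι)) := by
  obtain ⟨l, hl, hlw⟩ := exists_reduced_word b w
  rcases List.eq_nil_or_concat l with rfl | ⟨l, i, rfl⟩
  · exact absurd hlw.symm hw
  refine ⟨i, fun hpos => ?_⟩
  have h1 : w * simpleRefl b i = (l.map (simpleRefl b)).prod := by
    simp [← hlw, mul_assoc, simpleRefl_mul_self]
  have h2 : ¬ b.IsPos ((w * simpleRefl b i) • (i : ι)) := by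
    rw [mul_smul, simpleRefl_eq, ofIdx_smul_index, smul_reflectionPerm, isPos_neg_iff, not_not]
    exact hpos
  have h3 := length_mul_lt b h2
  have h4 := length_prod_le b l
  rw [mul_assoc, simpleRefl_mul_self, mul_one, ← hl, h1] at h3
  simp at h3
  omega

/-- Conjugation by a descent that does not commute with an involution shortens it. -/
theorem length_conj_lt [Finite ι] [P.IsReduced] (b : P.Base) {w : P.weylGroup} (hw : w * w = 1)
    {i : b.support} (h : ¬ b.IsPos (w • (i : ι)))
    (hc : simpleRefl b i * w ≠ w * simpleRefl b i) :
    length b (simpleRefl b i * w * simpleRefl b i) < length b w := by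
  rw [Ne, simpleRefl_mul_comm_iff, not_or] at hc
  have h1 : ¬ b.IsPos ((simpleRefl b i * w) • (i : ι)) := by
    rw [← isPos_neg_iff] at h ⊢
    have h' := smul_reflectionPerm (weylGroup.ofIdx P i) (w • (i : ι)) (w • (i : ι))
    rw [mul_smul, simpleRefl_eq, ← h', ofIdx_smul_index]
    exact isPos_reflectionPerm b i h fun h' => hc.2 <| by
      rw [← neg_neg_index (P := P) (w • (i : ι)), h']
  have h2 := length_mul_lt b h1
  have h3 := length_mul_lt b h
  have h4 := length_inv_le b (w * simpleRefl b i)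
  have h5 : (w * simpleRefl b i)⁻¹ = simpleRefl b i * w := by
    rw [mul_inv_rev, inv_eq_of_mul_eq_one_left hw,
      inv_eq_of_mul_eq_one_left (simpleRefl_mul_self b i)]
  rw [h5] at h4
  omega

/-! ### Roots negated by an involution -/

theorem mem_posNegated {b : P.Base} {w : P.weylGroup} {i : ι} :
    i ∈ posNegated b w ↔ b.IsPos i ∧ w • i = P.reflectionPerm i i := by
  rw [posNegated, Set.mem_ofPred_eq, smul_root, ← reflection_apply_self, ← root_reflectionPerm,
    P.root.injective.eq_iff]

theorem isPosSubsystem_posNegated (b : P.Base) (w : P.weylGroup) :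
    IsPosSubsystem b (posNegated b w) where
  pos i hi := hi.1
  closed i hi j hj := by
    have h : w • P.root (P.reflectionPerm j i) = -P.root (P.reflectionPerm j i) := by
      rw [root_reflectionPerm, reflection_apply_root, smul_sub, smul_comm, hi.2, hj.2]
      module
    by_cases hpos : b.IsPos (P.reflectionPerm j i)
    · exact Or.inl ⟨hpos, h⟩
    · refine Or.inr ⟨(isPos_neg_iff b _).2 hpos, ?_⟩
      rw [root_reflectionPerm, reflection_apply_self, smul_neg, h]

theorem reflectionPerm_mem_posNegated [Finite ι] [P.IsReduced] (b : P.Base) {w : P.weylGroup}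
    {i : ι} {a : b.support} (ha : (a : ι) ∈ posNegated b w) (hi : i ∈ posNegated b w)
    (hia : i ≠ a) : P.reflectionPerm a i ∈ posNegated b w := by
  refine ((isPosSubsystem_posNegated b w).closed i hi a ha).resolve_right fun h => ?_
  exact (isPos_neg_iff b _).1 h.1 (isPos_reflectionPerm b a hi.1 hia)

/-- Multiplying an involution by the reflection in a negated root cuts the set of negated roots
down to the orthogonal complement of that root. -/
theorem posNegated_mul_ofIdx {b : P.Base} {w : P.weylGroup} {j : ι} (hj : j ∈ posNegated b w) :
    posNegated b (w * weylGroup.ofIdx P j) = perp P (posNegated b w) j := by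
  have hwj := (mem_posNegated.1 hj).2
  have hfix : (w * weylGroup.ofIdx P j) • j = j := by
    rw [mul_smul, ofIdx_smul_index, smul_reflectionPerm, hwj, neg_neg_index]
  ext i
  rw [mem_perp, mem_posNegated, mem_posNegated, and_assoc]
  refine and_congr_right fun _ => ?_
  constructor
  · intro h
    have h0 : P.pairing i j = 0 := by
      have := pairing_smul_smul (w * weylGroup.ofIdx P j) i j
      rw [h, hfix, pairing_reflectionPerm_self_left] at this
      omega
    refine ⟨?_, h0⟩
    rwa [mul_smul, ofIdx_smul_index, P.reflectionPerm_eq_of_pairing_eq_zero h0] at h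
  · rintro ⟨h, h0⟩
    rwa [mul_smul, ofIdx_smul_index, P.reflectionPerm_eq_of_pairing_eq_zero h0]

/-- An involution which negates no root is trivial. -/
theorem eq_one_of_posNegated_eq_empty [Finite ι] [P.IsReduced] {b : P.Base} {w : P.weylGroup}
    (hw : w * w = 1) (h : posNegated b w = ∅) : w = 1 := by
  induction hn : length b w using Nat.strong_induction_on generalizing w with
  | _ n ih =>
  by_contra hne
  obtain ⟨i, hi⟩ := exists_descent b hne
  have hipos : b.IsPos i := RootPairing.Base.isPos_of_mem_support i.2
  by_cases hc : simpleRefl b i * w = w * simpleRefl b i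
  · rcases (simpleRefl_mul_comm_iff b i w).1 hc with h1 | h1
    · rw [h1] at hi
      exact hi hipos
    · exact (h ▸ mem_posNegated.2 ⟨hipos, h1⟩ : (i : ι) ∈ (∅ : Set ι))
  · -- the shorter involution obtained by conjugation does not negate any root either
    have hlt := length_conj_lt b hw hi hc
    have hw' : simpleRefl b i * w * simpleRefl b i ∈ involutions P :=
      conj_mem_involutions b i ⟨w, hw⟩
    have h1 := ih _ (hn ▸ hlt) hw' ?_ rfl
    · refine hne ?_
      have h2 := congrArg (fun v => simpleRefl b i * v * simpleRefl b i) h1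
      simp only [mul_assoc, simpleRefl_mul_self, mul_one] at h2
      rwa [← mul_assoc, simpleRefl_mul_self, one_mul] at h2
    · rw [Set.eq_empty_iff_forall_notMem]
      intro j hj
      have h2 := (mem_posNegated.1 hj).2
      obtain ⟨k, hk⟩ : ∃ k, simpleRefl b i • j = k := ⟨_, rfl⟩
      have h3 : w • k = P.reflectionPerm k k := by
        have h4 := congrArg (simpleRefl b i • ·) h2
        simp only [smul_reflectionPerm, hk] at h4
        rwa [mul_smul, hk, mul_smul, ← mul_smul, simpleRefl_mul_self, one_smul] at h4
      by_cases hpos : b.IsPos k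
      · exact (h ▸ mem_posNegated.2 ⟨hpos, h3⟩ : k ∈ (∅ : Set ι))
      · refine (h ▸ mem_posNegated.2 ⟨(isPos_neg_iff b k).2 hpos, ?_⟩ :
          P.reflectionPerm k k ∈ (∅ : Set ι))
        rw [smul_reflectionPerm, h3]

/-! ### Involutions as products over their cascades -/

theorem mul_ofIdx_of_mem_posNegated {b : P.Base} {w : P.weylGroup} {j : ι}
    (hj : j ∈ posNegated b w) : w * weylGroup.ofIdx P j = weylGroup.ofIdx P j * w := by
  rw [mul_ofIdx, (mem_posNegated.1 hj).2, ofIdx_neg]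

theorem mul_ofIdx_mem_involutions {b : P.Base} {w : P.weylGroup} (hw : w * w = 1) {j : ι}
    (hj : j ∈ posNegated b w) :
    w * weylGroup.ofIdx P j * (w * weylGroup.ofIdx P j) = 1 := by
  have h := mul_ofIdx_of_mem_posNegated hj
  calc _ = w * (weylGroup.ofIdx P j * w) * weylGroup.ofIdx P j := by simp only [mul_assoc]
    _ = w * w * (weylGroup.ofIdx P j * weylGroup.ofIdx P j) := by
      rw [← h]; simp only [mul_assoc]
    _ = 1 := by rw [hw, ofIdx_mul_self, one_mul]

/-- An involution is the product of the reflections in its cascade. This is the resulting formula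
for its action on coroots. -/
theorem IsCascadeList.coAct_coroot [Finite ι] [P.IsReduced] {b : P.Base} {w : P.weylGroup}
    (hw : w * w = 1) {l : List ι} (hl : IsCascadeList P (posNegated b w) l) (i : ι) :
    coAct P w (P.coroot i) = P.coroot i - (l.map fun β => P.pairing β i • P.coroot β).sum := by
  induction l generalizing w i with
  | nil => simp [eq_one_of_posNegated_eq_empty hw hl, coAct_one]
  | cons θ l ih =>
    have hθ := hl.1
    have htail := hl.2.2
    rw [← posNegated_mul_ofIdx hθ] at htail
    have ih' := ih (mul_ofIdx_mem_involutions hw hθ) htail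
    have hfix : coAct P w (P.coroot θ) = -P.coroot θ := by
      rw [InvolutionLift.coAct_coroot, (mem_posNegated.1 hθ).2, coroot_reflectionPerm,
        coreflection_apply_self]
    have h1 : coAct P w (P.coroot i) = coAct P (w * weylGroup.ofIdx P θ) (P.coroot i) -
        P.pairing θ i • P.coroot θ := by
      rw [coAct_mul, coAct_ofIdx, coreflection_apply_coroot, map_sub, map_smul, hfix]
      module
    rw [h1, ih', List.map_cons, List.sum_cons]
    abel

theorem IsCascadeList.two_smul_coroot [Finite ι] [P.IsReduced] {b : P.Base} {w : P.weylGroup}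
    (hw : w * w = 1) {l : List ι} (hl : IsCascadeList P (posNegated b w) l) {i : ι}
    (hi : i ∈ posNegated b w) :
    (2 : ℤ) • P.coroot i = (l.map fun β => P.pairing β i • P.coroot β).sum := by
  have h := hl.coAct_coroot hw i
  rw [InvolutionLift.coAct_coroot, (mem_posNegated.1 hi).2, coroot_reflectionPerm,
    coreflection_apply_self] at h
  rw [two_smul]
  exact (neg_add_eq_iff_eq_add.1 (eq_sub_iff_add_eq.1 h)).symm

theorem IsCascadeList.map {A : Set ι} {l : List ι} (hl : IsCascadeList P A l) (w : P.weylGroup) :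
    IsCascadeList P ((w • ·) '' A) (l.map (w • ·)) := by
  induction l generalizing A with
  | nil => rw [show A = ∅ from hl]; exact Set.image_empty _
  | cons θ l ih =>
    refine ⟨⟨θ, hl.1, rfl⟩, ?_, ?_⟩
    · rintro _ ⟨i, hi, rfl⟩ hne
      simp only [pairing_smul_smul]
      exact hl.2.1 i hi fun h => hne (h ▸ rfl)
    · convert ih hl.2.2 using 1
      ext i
      constructor
      · rintro ⟨⟨j, hj, rfl⟩, h⟩
        simp only [pairing_smul_smul] at h
        exact ⟨j, ⟨hj, h⟩, rfl⟩
      · rintro ⟨j, ⟨hj, h⟩, rfl⟩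
        refine ⟨⟨j, hj, rfl⟩, ?_⟩
        simp only [pairing_smul_smul]
        exact h

theorem coAct_list_sum (w : P.weylGroup) (l : List ι) :
    coAct P w (l.map P.coroot).sum = ((l.map (w • ·)).map P.coroot).sum := by
  rw [map_list_sum, List.map_map, List.map_map]
  congr 2
  funext i
  exact coAct_coroot w i

/-- Conjugating by a simple reflection that does not commute with `w` transports the roots negated
by `w`. -/
theorem posNegated_conj [Finite ι] [P.IsReduced] (b : P.Base) (i : b.support) {w : P.weylGroup}
    (h : simpleRefl b i * w ≠ w * simpleRefl b i) :
    posNegated b (simpleRefl b i * w * simpleRefl b i) =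
      (simpleRefl b i • ·) '' posNegated b w := by
  rw [Ne, simpleRefl_mul_comm_iff, not_or] at h
  have hs (j : ι) : simpleRefl b i • simpleRefl b i • j = j := by
    rw [← mul_smul, simpleRefl_mul_self, one_smul]
  have key (j : ι) : (simpleRefl b i * w * simpleRefl b i) • simpleRefl b i • j =
      simpleRefl b i • w • j := by
    rw [mul_smul, hs, mul_smul]
  ext j
  constructor
  · intro hj
    have hj' := mem_posNegated.1 hj
    refine ⟨simpleRefl b i • j, mem_posNegated.2 ⟨?_, ?_⟩, hs j⟩
    · refine isPos_reflectionPerm b i hj'.1 ?_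
      rintro rfl
      have h2 := hj'.2
      rw [mul_smul, mul_smul, simpleRefl_eq, ofIdx_smul_index, ofIdx_smul_index,
        smul_reflectionPerm, reflectionPerm_eq_comm, reflectionPerm_self] at h2
      exact h.2 (by rw [← neg_neg_index (P := P) (w • (i : ι)), h2])
    · have h2 := congrArg (simpleRefl b i • ·) hj'.2
      simp only [smul_reflectionPerm] at h2
      rwa [mul_smul, mul_smul, hs] at h2
  · rintro ⟨j, hj, rfl⟩
    have hj' := mem_posNegated.1 hj
    refine mem_posNegated.2 ⟨isPos_reflectionPerm b i hj'.1 ?_, ?_⟩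
    · rintro rfl
      exact h.2 hj'.2
    · dsimp only
      rw [key, hj'.2, smul_reflectionPerm]

/-- In the simply laced case all pairings are symmetric. -/
theorem pairing_symm_of_isSimplyLaced [Finite ι] [P.IsReduced] (b : P.Base)
    (hb : b.cartanMatrix.IsSimplyLaced) (i j : ι) : P.pairing i j = P.pairing j i := by
  classical
  have hsym (i j : ι) (hi : i ∈ b.support) (hj : j ∈ b.support) :
      P.pairing i j = P.pairing j i := by
    by_cases hij : i = j
    · rw [hij]
    have h1 := hb (show (⟨i, hi⟩ : b.support) ≠ ⟨j, hj⟩ by simpa using hij)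
    have h2 := hb (show (⟨j, hj⟩ : b.support) ≠ ⟨i, hi⟩ by simpa using Ne.symm hij)
    simp only [Base.cartanMatrix, Base.cartanMatrixIn_def, pairingIn_int] at h1 h2
    have h3 : P.pairing i j = 0 ↔ P.pairing j i = 0 := P.pairing_eq_zero_iff'
    omega
  have hsimple (i : ι) : ∀ k ∈ b.support, P.pairing i k = P.pairing k i := by
    refine b.induction_reflect i (p := fun i => ∀ k ∈ b.support, P.pairing i k = P.pairing k i)
      ?_ ?_ ?_
    · intro i hi k hk
      rw [pairing_reflectionPerm_self_left, pairing_reflectionPerm_self_right, hi k hk]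
    · exact fun i hi k hk => hsym i k hi hk
    · intro i j hi hj k hk
      rw [pairing_reflectionPerm_left, pairing_reflectionPerm_right, hi k hk, hi j hj,
        hsym j k hj hk]
  refine b.induction_reflect j (p := fun j => P.pairing i j = P.pairing j i) ?_ ?_ ?_
  · intro j hj
    rw [pairing_reflectionPerm_self_left, pairing_reflectionPerm_self_right, hj]
  · exact fun j hj => hsimple i j hj
  · intro j k hj hk
    rw [pairing_reflectionPerm_left, pairing_reflectionPerm_right, hj, hsimple j k hk,
      hsimple i k hk, mul_comm]

/-! ### The lift given by the cascades -/

/-- The sum of the coroots of Kostant's cascade of the roots negated by `w`. -/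
noncomputable def cascadeSum (b : P.Base) (w : P.weylGroup) : Y :=
  ∑ᶠ k ∈ cascade P (posNegated b w), P.coroot k

theorem IsCascadeList.cascadeSum_eq {b : P.Base} {w : P.weylGroup} {l : List ι}
    (hl : IsCascadeList P (posNegated b w) l) : cascadeSum b w = (l.map P.coroot).sum :=
  hl.finsum_cascade (isPosSubsystem_posNegated b w)

theorem coroot_mem_corootLattice (b : P.Base) (i : ι) : P.coroot i ∈ corootLattice b := by
  have h := b.coroot_mem_span_int i
  rwa [← Submodule.mem_toAddSubgroup, Submodule.span_int_eq_addSubgroupClosure] at h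

theorem zsmul_coroot_injective (i : ι) {m n : ℤ} (h : m • P.coroot i = n • P.coroot i) :
    m = n := by
  have h1 := congrArg (P.toLinearMap (P.root i)) h
  simp only [map_smul, root_coroot_two, smul_eq_mul] at h1
  omega

theorem eq_zero_of_zsmul_coroot_eq (b : P.Base) {i j : b.support} (hij : i ≠ j) {m n : ℤ}
    (h : m • P.coroot i = n • P.coroot j) : m = 0 := by
  have h1 : LinearIndependent ℤ ![P.coroot i, P.coroot j] :=
    b.flip.linearIndependent_pair_of_ne hij
  refine (LinearIndependent.pair_iff.1 h1 m (-n) ?_).1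
  rw [h, neg_smul, add_neg_cancel]

theorem IsCoeff.neg {n : ℤ} (hn : IsCoeff P n) : IsCoeff P (-n) :=
  ⟨by have := hn.1; omega, fun h => hn.2 (by omega)⟩

theorem posNegated_one (b : P.Base) : posNegated b (1 : P.weylGroup) = ∅ := by
  rw [Set.eq_empty_iff_forall_notMem]
  intro i hi
  obtain ⟨h1, h2⟩ := mem_posNegated.1 hi
  rw [one_smul] at h2
  rw [h2] at h1
  exact (isPos_neg_iff b i).1 h1 (h2 ▸ h1)

theorem posNegated_simpleRefl [P.IsReduced] (b : P.Base) (i : b.support) :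
    posNegated b (simpleRefl b i) = {(i : ι)} := by
  have hpos : b.IsPos i := RootPairing.Base.isPos_of_mem_support i.2
  ext j
  rw [mem_posNegated, Set.mem_singleton_iff]
  constructor
  · rintro ⟨h1, h2⟩
    rw [simpleRefl_eq, ofIdx_smul_index] at h2
    rcases eq_or_eq_neg_of_reflectionPerm_eq h2.symm with h | h
    · exact h
    · rw [h, isPos_neg_iff] at h1
      exact absurd hpos h1
  · rintro rfl
    exact ⟨hpos, rfl⟩

section

variable [Finite ι] [P.IsReduced] (b : P.Base)

theorem exists_isCascadeList_posNegated (w : P.weylGroup) :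
    ∃ l, IsCascadeList P (posNegated b w) l :=
  (isPosSubsystem_posNegated b w).exists_isCascadeList

theorem cascadeSum_mem (w : P.weylGroup) : cascadeSum b w ∈ corootLattice b := by
  obtain ⟨l, hl⟩ := exists_isCascadeList_posNegated b w
  rw [hl.cascadeSum_eq]
  refine AddSubgroup.list_sum_mem _ fun y hy => ?_
  obtain ⟨i, -, rfl⟩ := List.mem_map.1 hy
  exact coroot_mem_corootLattice b i

theorem cascadeSum_conj {w : P.weylGroup} {i : b.support}
    (h : simpleRefl b i * w ≠ w * simpleRefl b i) :
    coAct P (simpleRefl b i) (cascadeSum b w) =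
      cascadeSum b (simpleRefl b i * w * simpleRefl b i) := by
  obtain ⟨l, hl⟩ := exists_isCascadeList_posNegated b w
  have hl' := hl.map (simpleRefl b i)
  rw [← posNegated_conj b i h] at hl'
  rw [hl.cascadeSum_eq, hl'.cascadeSum_eq, coAct_list_sum]

/-- Multiplying an involution that negates a simple root by the simple reflection. -/
theorem cascadeSum_eq_add_of_mem {w : P.weylGroup} (hw : w * w = 1) {i : b.support}
    (hi : (i : ι) ∈ posNegated b w) : ∃ n, IsCoeff P n ∧
      cascadeSum b w = cascadeSum b (w * simpleRefl b i) + n • P.coroot i := by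
  obtain ⟨l, hl⟩ := exists_isCascadeList_posNegated b w
  obtain ⟨l', hl', n, hn, hsum⟩ := hl.exists_perp (isPosSubsystem_posNegated b w) hi
    (fun j hj hji => reflectionPerm_mem_posNegated b hi hj hji) (hl.two_smul_coroot hw hi)
  rw [← posNegated_mul_ofIdx hi] at hl'
  exact ⟨n, hn, by rw [hl.cascadeSum_eq, simpleRefl_eq, hl'.cascadeSum_eq, hsum]⟩

theorem cascadeSum_mul {w : P.weylGroup} (hw : w * w = 1) {i : b.support}
    (h : simpleRefl b i * w = w * simpleRefl b i) : ∃ n, IsCoeff P n ∧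
      cascadeSum b (simpleRefl b i * w) = cascadeSum b w + n • P.coroot i := by
  have hpos : b.IsPos i := RootPairing.Base.isPos_of_mem_support i.2
  rcases (simpleRefl_mul_comm_iff b i w).1 h with h1 | h1
  · have hi : (i : ι) ∈ posNegated b (simpleRefl b i * w) := by
      rw [mem_posNegated, mul_smul, h1]
      exact ⟨hpos, rfl⟩
    obtain ⟨n, hn, hsum⟩ :=
      cascadeSum_eq_add_of_mem b (mul_mem_involutions b i ⟨w, hw⟩ h) hi
    refine ⟨n, hn, ?_⟩
    rwa [h, mul_assoc, simpleRefl_mul_self, mul_one, ← h] at hsum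
  · obtain ⟨n, hn, hsum⟩ := cascadeSum_eq_add_of_mem b hw (mem_posNegated.2 ⟨hpos, h1⟩)
    refine ⟨-n, hn.neg, ?_⟩
    rw [hsum, h]
    module

/-- The map `w ↦ r_w` given by the cascade sums. -/
noncomputable def cascadeLift (w : involutions P) : corootLattice b :=
  ⟨cascadeSum b w, cascadeSum_mem b w⟩

theorem isInvolutionLift_cascadeLift : IsInvolutionLift b (cascadeLift b) where
  map_one := by
    have hl : IsCascadeList P (posNegated b (1 : P.weylGroup)) [] := posNegated_one b
    exact Subtype.ext hl.cascadeSum_eq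
  map_simple i := by
    have hl : IsCascadeList P (posNegated b (simpleRefl b i)) [(i : ι)] := by
      rw [posNegated_simpleRefl]
      refine ⟨rfl, fun j hj hji => absurd hj hji, ?_⟩
      change perp P {(i : ι)} i = ∅
      rw [Set.eq_empty_iff_forall_notMem]
      rintro j ⟨rfl, hj⟩
      rw [pairing_same] at hj
      omega
    refine Subtype.ext (hl.cascadeSum_eq.trans ?_)
    simp [simpleCoroot]
  map_conj w i h := cascadeSum_conj b h
  map_mul w i h := by
    obtain ⟨n, -, hn⟩ := cascadeSum_mul b w.2 h
    exact ⟨n, Subtype.ext hn⟩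

/-! ### Uniqueness of the lift -/

/-- An involution `w` that negates the simple root `i` and is not the reflection in it has another
descent: any descent of `w s_i ≠ 1` is one. -/
theorem exists_second_descent {w : P.weylGroup} (hw : w * w = 1) {i : b.support}
    (hi : w • (i : ι) = P.reflectionPerm i i) (hne : w ≠ simpleRefl b i) :
    ∃ j : b.support, j ≠ i ∧ ¬ b.IsPos (w • (j : ι)) := by
  have hc := (simpleRefl_mul_comm_iff b i w).2 (Or.inr hi)
  have hne' : w * simpleRefl b i ≠ 1 := fun h => hne <| by
    rw [eq_inv_of_mul_eq_one_left h, inv_eq_of_mul_eq_one_left (simpleRefl_mul_self b i)]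
  obtain ⟨j, hj⟩ := exists_descent b hne'
  have hipos : b.IsPos i := RootPairing.Base.isPos_of_mem_support i.2
  have hjpos : b.IsPos j := RootPairing.Base.isPos_of_mem_support j.2
  refine ⟨j, ?_, fun hpos => hj ?_⟩
  · rintro rfl
    refine hj ?_
    rw [mul_smul, simpleRefl_eq, ofIdx_smul_index, smul_reflectionPerm, hi, neg_neg_index]
    exact hipos
  · rw [← hc, mul_smul]
    refine isPos_reflectionPerm b i hpos fun h => ?_
    have h1 : (j : ι) = w • (i : ι) := by rw [← h, ← mul_smul, hw, one_smul]
    rw [hi] at h1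
    rw [h1, isPos_neg_iff] at hjpos
    exact hjpos hipos

/-- Induction on the length of `w`. If some descent does not commute with `w`, the values at `w`
come from a shorter conjugate. Otherwise `w = s_i`, or there are two descents, and both of their
coroots span the difference of the values at `w`. -/
theorem IsInvolutionLift.eq {b : P.Base} {r r' : involutions P → corootLattice b}
    (hr : IsInvolutionLift b r) (hr' : IsInvolutionLift b r') : r = r' := by
  funext w
  induction hn : length b (w : P.weylGroup) using Nat.strong_induction_on generalizing w with
  | _ n ih =>
  obtain ⟨w, hw⟩ := w
  dsimp only at hn
  by_cases h1 : w = 1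
  · subst h1
    exact hr.map_one.trans hr'.map_one.symm
  by_cases hcomm : ∀ i : b.support, ¬ b.IsPos (w • (i : ι)) →
      simpleRefl b i * w = w * simpleRefl b i
  · -- each descent `i` shows that `r w` and `r' w` differ by a multiple of the coroot of `i`
    have key (i : b.support) (hi : ¬ b.IsPos (w • (i : ι))) :
        ∃ m : ℤ, ((r ⟨w, hw⟩ : Y) - r' ⟨w, hw⟩) = m • P.coroot i := by
      have hc := hcomm i hi
      let v : involutions P := ⟨simpleRefl b i * w, mul_mem_involutions b i ⟨w, hw⟩ hc⟩
      have hv : simpleRefl b i * v = w := by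
        rw [← mul_assoc, simpleRefl_mul_self, one_mul]
      have hcv : simpleRefl b i * v = v * simpleRefl b i := by
        rw [hv]
        change w = simpleRefl b i * w * simpleRefl b i
        rw [hc, mul_assoc, simpleRefl_mul_self, mul_one]
      have hlt : length b (v : P.weylGroup) < n := by
        change length b (simpleRefl b i * w) < n
        rw [hc, ← hn]
        exact length_mul_lt b hi
      have heq := ih _ hlt v rfl
      have hvw : (⟨simpleRefl b i * v, mul_mem_involutions b i v hcv⟩ : involutions P) = ⟨w, hw⟩ :=
        Subtype.ext hv
      obtain ⟨m, hm⟩ := hr.map_mul v i hcv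
      obtain ⟨m', hm'⟩ := hr'.map_mul v i hcv
      rw [hvw] at hm hm'
      refine ⟨m - m', ?_⟩
      rw [hm, hm', heq]
      simp only [AddSubgroup.coe_add, AddSubgroup.coe_zsmul, simpleCoroot]
      module
    obtain ⟨i, hi⟩ := exists_descent b h1
    have hipos : b.IsPos i := RootPairing.Base.isPos_of_mem_support i.2
    have hi' : w • (i : ι) = P.reflectionPerm i i := by
      refine ((simpleRefl_mul_comm_iff b i w).1 (hcomm i hi)).resolve_left fun h => ?_
      rw [h] at hi
      exact hi hipos
    by_cases hwi : w = simpleRefl b i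
    · subst hwi
      exact (hr.map_simple i).trans (hr'.map_simple i).symm
    obtain ⟨j, hji, hj⟩ := exists_second_descent b hw hi' hwi
    obtain ⟨m, hm⟩ := key i hi
    obtain ⟨m', hm'⟩ := key j hj
    have h0 := eq_zero_of_zsmul_coroot_eq b hji.symm (hm.symm.trans hm')
    rw [h0, zero_smul, sub_eq_zero] at hm
    exact Subtype.ext hm
  · push Not at hcomm
    obtain ⟨i, hi, hc⟩ := hcomm
    let v : involutions P := ⟨simpleRefl b i * w * simpleRefl b i,
      conj_mem_involutions b i ⟨w, hw⟩⟩
    have hsv : simpleRefl b i * v = w * simpleRefl b i := by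
      change simpleRefl b i * (simpleRefl b i * w * simpleRefl b i) = _
      rw [← mul_assoc, ← mul_assoc, simpleRefl_mul_self, one_mul]
    have hvs : v * simpleRefl b i = simpleRefl b i * w := by
      change simpleRefl b i * w * simpleRefl b i * simpleRefl b i = _
      rw [mul_assoc, simpleRefl_mul_self, mul_one]
    have hcv : simpleRefl b i * v ≠ v * simpleRefl b i := by
      rw [hsv, hvs]; exact hc.symm
    have hvw : (⟨simpleRefl b i * v * simpleRefl b i, conj_mem_involutions b i v⟩ :
        involutions P) = ⟨w, hw⟩ :=
      Subtype.ext <| by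
        change simpleRefl b i * v * simpleRefl b i = w
        rw [hsv, mul_assoc, simpleRefl_mul_self, mul_one]
    have heq := ih _ (hn ▸ length_conj_lt b hw hi hc : length b (v : P.weylGroup) < n) v rfl
    have e1 := hr.map_conj v i hcv
    have e2 := hr'.map_conj v i hcv
    rw [hvw] at e1 e2
    exact Subtype.ext (by rw [← e1, ← e2, heq])

/-! ### Symmetries of the cascade sums -/

theorem coAct_cascadeSum_self (w : P.weylGroup) :
    coAct P w (cascadeSum b w) = -cascadeSum b w := by
  obtain ⟨l, hl⟩ := exists_isCascadeList_posNegated b w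
  rw [hl.cascadeSum_eq, ← neg_one_smul ℤ, List.smul_sum, map_list_sum, List.map_map,
    List.map_map]
  refine congrArg List.sum (List.map_congr_left fun β hβ => ?_)
  rw [Function.comp_apply, InvolutionLift.coAct_coroot, (mem_posNegated.1 (hl.mem β hβ)).2,
    coroot_reflectionPerm, coreflection_apply_self, Function.comp_apply, neg_one_smul]

/-- If `w` fixes the simple root `i`, then that root is orthogonal to all roots negated by `w`. -/
theorem coAct_simpleRefl_cascadeSum {w : P.weylGroup} {i : b.support}
    (hi : w • (i : ι) = i) : coAct P (simpleRefl b i) (cascadeSum b w) = cascadeSum b w := by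
  obtain ⟨l, hl⟩ := exists_isCascadeList_posNegated b w
  rw [hl.cascadeSum_eq, map_list_sum, List.map_map]
  refine congrArg List.sum (List.map_congr_left fun β hβ => ?_)
  have h := pairing_smul_smul w (i : ι) β
  rw [hi, (mem_posNegated.1 (hl.mem β hβ)).2, pairing_reflectionPerm_self_right] at h
  rw [Function.comp_apply, simpleRefl_eq, coAct_ofIdx, coreflection_apply_coroot,
    show P.pairing i β = 0 by omega, zero_smul, sub_zero]

end

end InvolutionLift

open InvolutionLift

theorem theorem0p2 {ι X Y : Type*} [Finite ι]
    [AddCommGroup X] [AddCommGroup Y] [Module.Finite ℤ X] [Module.Finite ℤ Y]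
    (P : RootPairing ι ℤ X Y) [P.IsReduced] (b : P.Base) :
    (∃! r : involutions P → corootLattice b, IsInvolutionLift b r) ∧
    ∀ r : involutions P → corootLattice b, IsInvolutionLift b r →
      (∀ (w : involutions P) (i : b.support)
        (h : simpleRefl b i * w = w * simpleRefl b i) (n : ℤ),
        r ⟨simpleRefl b i * w, mul_mem_involutions b i w h⟩ = r w + n • simpleCoroot b i →
          (n = -1 ∨ n = 0 ∨ n = 1) ∧ (b.cartanMatrix.IsSimplyLaced → n = -1 ∨ n = 1)) ∧
      (∀ (w : involutions P) (i : b.support),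
        simpleRefl b i * w = w * simpleRefl b i →
        length b w < length b (simpleRefl b i * w) →
          coAct P (simpleRefl b i) (r w) = r w) ∧
      (∀ w : involutions P, coAct P w (r w) = -(r w : Y)) ∧
      (∀ w : involutions P, (r w : Y) = ∑ᶠ k ∈ cascade P (posNegated b w), P.coroot k) := by
  have hlift := isInvolutionLift_cascadeLift b
  refine ⟨⟨cascadeLift b, hlift, fun r hr => hr.eq hlift⟩, fun r hr => ?_⟩
  obtain rfl : r = cascadeLift b := hr.eq hlift
  refine ⟨fun w i h n hn => ?_, fun w i h hlt => ?_, fun w => coAct_cascadeSum_self b w,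
    fun w => rfl⟩
  · obtain ⟨m, hm, hsum⟩ := cascadeSum_mul b w.2 h
    have hn' : cascadeSum b (simpleRefl b i * w) = cascadeSum b w + n • P.coroot i :=
      congrArg Subtype.val hn
    obtain rfl := zsmul_coroot_injective (i : ι) (add_left_cancel (hn'.symm.trans hsum))
    refine ⟨hm.1, fun hb => ?_⟩
    have h0 : n ≠ 0 := fun h0 => by
      obtain ⟨j, k, hjk⟩ := hm.2 h0
      exact hjk (pairing_symm_of_isSimplyLaced b hb j k)
    have := hm.1
    omega
  · refine coAct_simpleRefl_cascadeSum b ?_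
    refine ((simpleRefl_mul_comm_iff b i w).1 h).resolve_right fun hi => ?_
    have hneg : ¬ b.IsPos ((w : P.weylGroup) • (i : ι)) := by
      rw [hi, isPos_neg_iff, not_not]
      exact RootPairing.Base.isPos_of_mem_support i.2
    have := length_mul_lt b hneg
    rw [← h] at this
    omega
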